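/- Let $d\in\{2,3\}$, let $\Omega\subset\mathbb{R}^d$ be a bounded Lipschitz domain, $\kappa\in L_\infty(\Omega;\mathbb{R}^{d\times d})$ symmetric and uniformly positive definite, $\beta\in\mathbb{R}^d$ constant, $\rho,\gamma:\mathbb{R}\to\mathbb{R}$ Lipschitz continuous, and $f\in L_2(\Omega)$. Consider $$-\operatorname{div}(\kappa\nabla u+\rho(u)\beta)+\gamma(u)=f \quad\text{in }\Omega,\qquad u\in H^1_0(\Omega). \tag{1}$$ Write $(\cdot,\cdot)$ and $\|\cdot\|$ for the $L_2(\Omega)$ inner product and norm. For a regular (conforming, simplicial) triangulation $\mathcal T$ of $\Omega$ let $V:=H^1(\mathcal T)=\prod_{T\in\mathcal T}H^1(T)$, with norm $\|v\|_V^2=\|v\|^2+\|\nabla v\|_{\mathcal T}^2$ ($\nabla v$ taken piecewise, $(\cdot,\cdot)_{\mathcal T}$ and $\|\cdot\|_{\mathcal T}$ the $L_2$ product and norm over the elements). The normal trace operator $\mathrm{tr}_n: H(\operatorname{div},\Omega)\to V^*$ is $\langle \mathrm{tr}_n(\tau),v\rangle_{\mathcal S}:=(v,\operatorname{div}\tau)+(\nabla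 v,\tau)_{\mathcal T}$; its range $H^{-1/2}(\mathcal S)$ carries the norm $\|\widehat\sigma\|_{-1/2,\mathcal S}:=\inf\{(\|\sigma\|^2+\|\operatorname{div}\sigma\|^2)^{1/2};\ \mathrm{tr}_n(\sigma)=\widehat\sigma\}$. Let $U:=H^1_0(\Omega)\times H^{-1/2}(\mathcal S)\times L_2(\Omega)\times L_2(\Omega)$ with $$\|(w,\widehat\tau,s,t)\|_U:=\bigl(\|\nabla w\|^2+\|\widehat\tau\|_{-1/2,\mathcal S}^2+\|s\|^2+\|t\|^2\bigr)^{1/2},$$ and define, for $v\in V$, $L(v):=(f,v)$ and $B:U\to V^*$ by $$(B(w,\widehat\tau,s,t))(v)=b(w,\widehat\tau,s,t;v):=(\kappa\nabla w+s\beta,\nabla v)_{\mathcal T}-\langle\widehat\tau,v\rangle_{\mathcal S}+(t,v).$$ A solution $u$ of (1) is identified with $\boldsymbol u:=(u,\mathrm{tr}_n(\kappa\nabla u+\rho(u)\beta),\rho(u),\gamma(u))\in U$. Let $C_F>0$. There is a constant $C>0$, depending only on $\Omega,\kappa,\beta,\rho,\gamma$ and $C_F$, such that for every function $c$ with $0<c(h)\to0$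 as $h\to0$, $h>0$, there is $h_0>0$ for which the following holds for all $0<h\le h_0$. Let $u$ be a solution of (1) for some $f\in L_2(\Omega)$. Let $\mathcal T$ be a regular triangulation of $\Omega$ and let $U_h\subset U$, $V_h\subset V$ be finite-dimensional subspaces; $h$ is the parameter of this discretization, for instance the maximal diameter of the elements. Suppose that there is a Fortin operator $\Pi_F:V\to V_h$ with $$\|\Pi_Fv\|_V\le C_F\|v\|_V,\qquad b(\boldsymbol w_h;v-\Pi_Fv)=0\qquad\forall v\in V,\ \boldsymbol w_h\in U_h .$$ Let $\boldsymbol u_h=(u_h,\widehat\sigma_h,q_h,r_h)\in U_h$ minimize $$\|B\boldsymbol w_h-L\|_{V_h^*}^2+\|\rho(w_h)-s_h\|^2+\|\gamma(w_h)-t_h\|^2$$ over all $\boldsymbol w_h=(w_h,\widehat\tau_h,s_h,t_h)\in U_h$, where $\|\cdot\|_{V_h^*}$ is the operator norm of the restriction to $V_h$, and suppose that $$\|u-u_h\|\le c(h)\,\|\nabla(u-u_h)\|.$$ Then $$\|\boldsymbol u-\boldsymbol u_h\|_U\le C\,\|\boldsymbol u-\boldsymbol w_h\|_U\qquad\forall\,\boldsymbol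 w_h\in U_h .$$ -/

import Mathlib

noncomputable section

namespace SemilinearDPG

open MeasureTheory Set Filter Topology
open scoped ENNReal NNReal ContDiff RealInnerProductSpace

/-- The space `ℝ^d` with its Euclidean norm. -/
abbrev Space (d : ℕ) : Type := EuclideanSpace ℝ (Fin d)

/-- A Lipschitz domain: a nonempty connected open set that, near every boundary point and in
suitable orthogonal coordinates (height in a unit direction `ν`, base `ν^⊥`), is the set of
points lying strictly below the graph of a Lipschitz function. -/
structure IsLipschitzDomain {d : ℕ} (Ω : Set (Space d)) : Prop where
  isOpen : IsOpen Ω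
  isConnected : IsConnected Ω
  boundary : ∀ x ∈ frontier Ω, ∃ ν : Space d, ‖ν‖ = 1 ∧
    ∃ (K : ℝ≥0) (g : (ℝ ∙ ν)ᗮ → ℝ), LipschitzWith K g ∧
      ∃ N ∈ 𝓝 x, ∀ y ∈ N, y ∈ Ω ↔ ⟪ν, y⟫ < g ((ℝ ∙ ν)ᗮ.orthogonalProjectionOnto y)

/-- The Lebesgue space `L_2(Ω)`. -/
abbrev L2 {d : ℕ} (Ω : Set (Space d)) : Type := Lp ℝ 2 (volume.restrict Ω)

/-- The Lebesgue space `L_2(Ω; ℝ^d)` of vector fields. -/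
abbrev L2Vec {d : ℕ} (Ω : Set (Space d)) : Type := Lp (Space d) 2 (volume.restrict Ω)

/-- Test functions: `φ ∈ C_c^∞(G)`. -/
structure IsTestFunction {d : ℕ} (G : Set (Space d)) (φ : Space d → ℝ) : Prop where
  smooth : ContDiff ℝ ∞ φ
  compact : HasCompactSupport φ
  supp : tsupport φ ⊆ G

/-- For an open subset `G` of `Ω`: the restriction of `g` to `G` is the weak gradient of the
restriction of `v` to `G`. The test functions vanish outside of `G`, so that integrating
over `Ω` is the same as integrating over `G`. -/
def IsWeakGradOn {d : ℕ} {Ω : Set (Space d)} (G : Set (Space d)) (v : L2 Ω) (g : L2Vec Ω) :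
    Prop :=
  ∀ φ : Space d → ℝ, IsTestFunction G φ →
    ∫ x in Ω, v x • gradient φ x = - ∫ x in Ω, φ x • g x

/-- `δ` is the weak divergence of the vector field `τ` in `Ω`. -/
def IsWeakDiv {d : ℕ} {Ω : Set (Space d)} (τ : L2Vec Ω) (δ : L2 Ω) : Prop :=
  ∀ φ : Space d → ℝ, IsTestFunction Ω φ →
    ∫ x in Ω, ⟪τ x, gradient φ x⟫ = - ∫ x in Ω, φ x * δ x

theorem IsTestFunction.memLp {d : ℕ} {G Ω : Set (Space d)} {φ : Space d → ℝ}
    (h : IsTestFunction G φ) : MemLp φ 2 (volume.restrict Ω) :=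
  (h.smooth.continuous.memLp_of_hasCompactSupport h.compact).restrict Ω

theorem IsTestFunction.memLp_gradient {d : ℕ} {G Ω : Set (Space d)} {φ : Space d → ℝ}
    (h : IsTestFunction G φ) : MemLp (gradient φ) 2 (volume.restrict Ω) := by
  have h1 : Continuous (gradient φ) := by
    unfold gradient
    exact (LinearIsometryEquiv.continuous _).comp (h.smooth.continuous_fderiv (by simp))
  have h2 : HasCompactSupport (gradient φ) := by
    have := h.compact.fderiv (𝕜 := ℝ)
    exact this.comp_left (g := (InnerProductSpace.toDual ℝ (Space d)).symm) (map_zero _)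
  exact (h1.memLp_of_hasCompactSupport h2).restrict Ω

/-- A regular (conforming) triangulation of `Ω` into finitely many nondegenerate simplices, each
given by its set of `d + 1` affinely independent vertices: the closed simplices cover the
closure of `Ω`, the open ones are pairwise disjoint and contained in `Ω`, and two of the closed
ones meet in the common face that is spanned by their common vertices (possibly none). -/
structure Triangulation {d : ℕ} (Ω : Set (Space d)) where
  cells : Set (Finset (Space d))
  finite : cells.Finite
  card_eq : ∀ s ∈ cells, s.card = d + 1
  indep : ∀ s ∈ cells, AffineIndependent ℝ ((↑) : s → Space d)
  cover : ⋃ s ∈ cells, convexHull ℝ (s : Set (Space d)) = closure Ω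
  interior_subset : ∀ s ∈ cells, interior (convexHull ℝ (s : Set (Space d))) ⊆ Ω
  disjoint : ∀ s ∈ cells, ∀ t ∈ cells, s ≠ t →
    Disjoint (interior (convexHull ℝ (s : Set (Space d))))
      (interior (convexHull ℝ (t : Set (Space d))))
  conforming : ∀ s ∈ cells, ∀ t ∈ cells,
    convexHull ℝ (s : Set (Space d)) ∩ convexHull ℝ (t : Set (Space d)) =
      convexHull ℝ ((s : Set (Space d)) ∩ (t : Set (Space d)))

/-- The elements `T` of the mesh, as open sets. -/
def Triangulation.elements {d : ℕ} {Ω : Set (Space d)} (𝒯 : Triangulation Ω) :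
    Set (Set (Space d)) :=
  (fun s : Finset (Space d) => interior (convexHull ℝ (s : Set (Space d)))) '' 𝒯.cells

/-- The Hilbert space `H^1_0(Ω)`: closure of `C_c^∞(Ω)` with respect to the norm
`(‖u‖² + ‖∇u‖²)^{1/2}`. An element is stored as the pair `(u, ∇u)`; the set whose span is
taken is the linear space of all pairs `(φ, ∇φ)` with a test function `φ`. -/
def H10 {d : ℕ} (Ω : Set (Space d)) : Submodule ℝ (WithLp 2 (L2 Ω × L2Vec Ω)) :=
  (Submodule.span ℝ {x : WithLp 2 (L2 Ω × L2Vec Ω) | ∃ φ : Space d → ℝ, IsTestFunction Ω φ ∧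
    x.fst =ᵐ[volume.restrict Ω] φ ∧
    x.snd =ᵐ[volume.restrict Ω] gradient φ}).topologicalClosure

/-- The function `u` of an element of `H^1_0(Ω)`. -/
def H10.val {d : ℕ} {Ω : Set (Space d)} (u : H10 Ω) : L2 Ω := u.1.fst

/-- The gradient `∇u` of an element of `H^1_0(Ω)`. -/
def H10.grad {d : ℕ} {Ω : Set (Space d)} (u : H10 Ω) : L2Vec Ω := u.1.snd

/-- The test space `V = H^1(𝒯) = ∏_T H^1(T)`. The families `(v_T)_T` are identified with the
functions `v ∈ L_2(Ω)` having restrictions `v|_T ∈ H^1(T)` for all `T ∈ 𝒯`; an element is stored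
as the pair of `v` and its piecewise gradient. The norm is
`(‖v‖² + ‖∇v‖_𝒯²)^{1/2}`. -/
def V {d : ℕ} {Ω : Set (Space d)} (𝒯 : Triangulation Ω) :
    Submodule ℝ (WithLp 2 (L2 Ω × L2Vec Ω)) where
  carrier := {x | ∀ T ∈ 𝒯.elements, IsWeakGradOn T x.fst x.snd}
  zero_mem' := by
    intro T _ φ hφ
    have h1 : ∫ x in Ω, ((0 : L2 Ω) : Space d → ℝ) x • gradient φ x = 0 := by
      apply integral_eq_zero_of_ae
      filter_upwards [Lp.coeFn_zero ℝ 2 (volume.restrict Ω)] with x hx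
      rw [hx]
      simp
    have h2 : ∫ x in Ω, φ x • ((0 : L2Vec Ω) : Space d → Space d) x = 0 := by
      apply integral_eq_zero_of_ae
      filter_upwards [Lp.coeFn_zero (Space d) 2 (volume.restrict Ω)] with x hx
      rw [hx]
      simp
    exact h1.trans (by rw [← neg_zero, ← h2]; rfl)
  add_mem' := by
    intro x y hx hy T hT φ hφ
    have hx1 := hx T hT φ hφ
    have hy1 := hy T hT φ hφ
    have i1 : ∀ w : L2 Ω, Integrable (fun z => w z • gradient φ z) (volume.restrict Ω) :=
      fun w => memLp_one_iff_integrable.1 ((hφ.memLp_gradient (Ω := Ω)).smul (Lp.memLp w))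
    have i2 : ∀ w : L2Vec Ω, Integrable (fun z => φ z • w z) (volume.restrict Ω) :=
      fun w => memLp_one_iff_integrable.1 ((Lp.memLp w).smul (hφ.memLp (Ω := Ω)))
    have e1 : ∫ z in Ω, (x + y).fst z • gradient φ z =
        ∫ z in Ω, (x.fst z • gradient φ z + y.fst z • gradient φ z) := by
      apply integral_congr_ae
      filter_upwards [Lp.coeFn_add x.fst y.fst] with z hz
      have : (x + y).fst z = x.fst z + y.fst z := hz
      rw [this, add_smul]
    have e2 : ∫ z in Ω, φ z • (x + y).snd z =
        ∫ z in Ω, (φ z • x.snd z + φ z • y.snd z) := by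
      apply integral_congr_ae
      filter_upwards [Lp.coeFn_add x.snd y.snd] with z hz
      have : (x + y).snd z = x.snd z + y.snd z := hz
      rw [this, smul_add]
    rw [e1, e2]
    rw [integral_add (i1 _) (i1 _), integral_add (i2 _) (i2 _), hx1, hy1, neg_add]
  smul_mem' := by
    intro c x hx T hT φ hφ
    have hx1 := hx T hT φ hφ
    have e1 : ∫ z in Ω, (c • x).fst z • gradient φ z =
        ∫ z in Ω, c • (x.fst z • gradient φ z) := by
      apply integral_congr_ae
      filter_upwards [Lp.coeFn_smul c x.fst] with z hz
      have : (c • x).fst z = c • x.fst z := hz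
      rw [this, smul_assoc]
    have e2 : ∫ z in Ω, φ z • (c • x).snd z = ∫ z in Ω, c • (φ z • x.snd z) := by
      apply integral_congr_ae
      filter_upwards [Lp.coeFn_smul c x.snd] with z hz
      have : (c • x).snd z = c • x.snd z := hz
      rw [this, smul_comm]
    rw [e1, e2, integral_smul, integral_smul, hx1, smul_neg]

/-- The embedding `V → L_2(Ω)`, `v ↦ v`. -/
def V.val {d : ℕ} {Ω : Set (Space d)} (𝒯 : Triangulation Ω) : V 𝒯 →L[ℝ] L2 Ω :=
  (WithLp.fstL 2 ℝ (L2 Ω) (L2Vec Ω)).comp (V 𝒯).subtypeL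

/-- The piecewise gradient `V → L_2(Ω; ℝ^d)`, `v ↦ ∇v`. -/
def V.grad {d : ℕ} {Ω : Set (Space d)} (𝒯 : Triangulation Ω) : V 𝒯 →L[ℝ] L2Vec Ω :=
  (WithLp.sndL 2 ℝ (L2 Ω) (L2Vec Ω)).comp (V 𝒯).subtypeL

/-- The space `H(div, Ω)`. An element is stored as the pair `(τ, div τ)`. The norm is
`(‖τ‖² + ‖div τ‖²)^{1/2}`. -/
def Hdiv {d : ℕ} (Ω : Set (Space d)) : Submodule ℝ (WithLp 2 (L2Vec Ω × L2 Ω)) where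
  carrier := {x | IsWeakDiv x.fst x.snd}
  zero_mem' := by
    intro φ hφ
    have h1 : ∫ x in Ω, ⟪((0 : L2Vec Ω) : Space d → Space d) x, gradient φ x⟫ = 0 := by
      apply integral_eq_zero_of_ae
      filter_upwards [Lp.coeFn_zero (Space d) 2 (volume.restrict Ω)] with x hx
      rw [hx]
      simp
    have h2 : ∫ x in Ω, φ x * ((0 : L2 Ω) : Space d → ℝ) x = 0 := by
      apply integral_eq_zero_of_ae
      filter_upwards [Lp.coeFn_zero ℝ 2 (volume.restrict Ω)] with x hx
      rw [hx]
      simp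
    exact h1.trans (by rw [← neg_zero, ← h2]; rfl)
  add_mem' := by
    intro x y hx hy φ hφ
    have hx1 := hx φ hφ
    have hy1 := hy φ hφ
    have i1 : ∀ w : L2Vec Ω, Integrable (fun z => ⟪w z, gradient φ z⟫) (volume.restrict Ω) := by
      intro w
      refine (L2.integrable_inner (𝕜 := ℝ) w (hφ.memLp_gradient (Ω := Ω)).toLp).congr ?_
      filter_upwards [(hφ.memLp_gradient (Ω := Ω)).coeFn_toLp] with z hz
      rw [hz]
    have i2 := fun w : L2 Ω => (Lp.memLp w).integrable_mul (hφ.memLp (Ω := Ω))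
    have i3 : ∀ w : L2 Ω, Integrable (fun z => φ z * w z) (volume.restrict Ω) := by
      intro w
      refine (i2 w).congr (Filter.Eventually.of_forall fun z => ?_)
      simp [mul_comm]
    have e1 : ∫ z in Ω, ⟪(x + y).fst z, gradient φ z⟫ =
        ∫ z in Ω, (⟪x.fst z, gradient φ z⟫ + ⟪y.fst z, gradient φ z⟫) := by
      apply integral_congr_ae
      filter_upwards [Lp.coeFn_add x.fst y.fst] with z hz
      have : (x + y).fst z = x.fst z + y.fst z := hz
      rw [this, inner_add_left]
    have e2 : ∫ z in Ω, φ z * (x + y).snd z =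
        ∫ z in Ω, (φ z * x.snd z + φ z * y.snd z) := by
      apply integral_congr_ae
      filter_upwards [Lp.coeFn_add x.snd y.snd] with z hz
      have : (x + y).snd z = x.snd z + y.snd z := hz
      rw [this, mul_add]
    rw [e1, e2, integral_add (i1 _) (i1 _), integral_add (i3 _) (i3 _), hx1, hy1, neg_add]
  smul_mem' := by
    intro c x hx φ hφ
    have hx1 := hx φ hφ
    have e1 : ∫ z in Ω, ⟪(c • x).fst z, gradient φ z⟫ =
        ∫ z in Ω, c * ⟪x.fst z, gradient φ z⟫ := by
      apply integral_congr_ae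
      filter_upwards [Lp.coeFn_smul c x.fst] with z hz
      have : (c • x).fst z = c • x.fst z := hz
      rw [this, real_inner_smul_left]
    have e2 : ∫ z in Ω, φ z * (c • x).snd z = ∫ z in Ω, c * (φ z * x.snd z) := by
      apply integral_congr_ae
      filter_upwards [Lp.coeFn_smul c x.snd] with z hz
      have : (c • x).snd z = c • x.snd z := hz
      rw [this, smul_eq_mul, mul_left_comm]
    rw [e1, e2, integral_const_mul, integral_const_mul, hx1, mul_neg]

/-- The normal trace operator `H(div, Ω) → H^1(𝒯)^*`,
`⟨tr_n(τ), v⟩ = (v, div τ) + (∇v, τ)_𝒯`. -/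
def trn {d : ℕ} {Ω : Set (Space d)} (𝒯 : Triangulation Ω) : Hdiv Ω →ₗ[ℝ] (V 𝒯 →L[ℝ] ℝ) where
  toFun τ := (innerSL ℝ τ.1.snd).comp (V.val 𝒯) + (innerSL ℝ τ.1.fst).comp (V.grad 𝒯)
  map_add' τ τ' := by
    ext v
    simp only [Submodule.coe_add, WithLp.add_fst, WithLp.add_snd, map_add,
      ContinuousLinearMap.add_comp, add_apply]
    ring
  map_smul' c τ := by
    ext v
    simp

/-- The trace space `H^{-1/2}(𝒮) = tr_n(H(div, Ω))`. -/
def TraceSpace {d : ℕ} {Ω : Set (Space d)} (𝒯 : Triangulation Ω) :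
    Submodule ℝ (V 𝒯 →L[ℝ] ℝ) :=
  LinearMap.range (trn 𝒯)

/-- The trace norm `inf {‖σ‖_div ; tr_n(σ) = σ̂}`. -/
def traceNorm {d : ℕ} {Ω : Set (Space d)} {𝒯 : Triangulation Ω} (σ' : TraceSpace 𝒯) : ℝ :=
  sInf ((fun σ : Hdiv Ω => ‖σ‖) '' {σ | trn 𝒯 σ = σ'.1})

/-- The trial space `U = H^1_0(Ω) × H^{-1/2}(𝒮) × L_2(Ω) × L_2(Ω)`. -/
def U {d : ℕ} {Ω : Set (Space d)} (𝒯 : Triangulation Ω) : Type :=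
  H10 Ω × TraceSpace 𝒯 × L2 Ω × L2 Ω

instance {d : ℕ} {Ω : Set (Space d)} (𝒯 : Triangulation Ω) : AddCommGroup (U 𝒯) :=
  inferInstanceAs (AddCommGroup (H10 Ω × TraceSpace 𝒯 × L2 Ω × L2 Ω))

instance {d : ℕ} {Ω : Set (Space d)} (𝒯 : Triangulation Ω) : Module ℝ (U 𝒯) :=
  inferInstanceAs (Module ℝ (H10 Ω × TraceSpace 𝒯 × L2 Ω × L2 Ω))

/-- The norm of `U`,
`‖(w, τ̂, s, t)‖_U = (‖∇w‖² + ‖τ̂‖_{-1/2,𝒮}² + ‖s‖² + ‖t‖²)^{1/2}`. -/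
def normU {d : ℕ} {Ω : Set (Space d)} {𝒯 : Triangulation Ω} (w : U 𝒯) : ℝ :=
  Real.sqrt (‖H10.grad w.1‖ ^ 2 + traceNorm w.2.1 ^ 2 + ‖w.2.2.1‖ ^ 2 + ‖w.2.2.2‖ ^ 2)

/-- The data of the model problem: a bounded Lipschitz domain `Ω ⊂ ℝ^d`, `d = 2, 3`, a symmetric,
uniformly positive definite coefficient `κ ∈ L_∞(Ω; ℝ^{d×d})`, a constant vector `β`, and
Lipschitz continuous functions `ρ`, `γ`. -/
structure ProblemData (d : ℕ) where
  dim : d = 2 ∨ d = 3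
  Ω : Set (Space d)
  lipschitz : IsLipschitzDomain Ω
  bounded : Bornology.IsBounded Ω
  κ : Lp (Space d →L[ℝ] Space d) ∞ (volume.restrict Ω)
  κ_symm : ∀ᵐ x ∂(volume.restrict Ω), ∀ ξ η : Space d, ⟪κ x ξ, η⟫ = ⟪ξ, κ x η⟫
  κ_pos : ∃ κ₀ : ℝ, 0 < κ₀ ∧
    ∀ᵐ x ∂(volume.restrict Ω), ∀ ξ : Space d, κ₀ * ‖ξ‖ ^ 2 ≤ ⟪κ x ξ, ξ⟫
  β : Space d
  ρ : ℝ → ℝ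
  ρ_lipschitz : ∃ K : ℝ≥0, LipschitzWith K ρ
  γ : ℝ → ℝ
  γ_lipschitz : ∃ K : ℝ≥0, LipschitzWith K γ

theorem memLp_comp {d : ℕ} {Ω : Set (Space d)} (hΩ : Bornology.IsBounded Ω) {ρ : ℝ → ℝ}
    (hρ : ∃ K : ℝ≥0, LipschitzWith K ρ) (w : L2 Ω) :
    MemLp (fun x => ρ (w x)) 2 (volume.restrict Ω) := by
  obtain ⟨K, hK⟩ := hρ
  have : IsFiniteMeasure (volume.restrict Ω) :=
    ⟨by rw [Measure.restrict_apply_univ]; exact hΩ.measure_lt_top⟩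
  have h1 : LipschitzWith K (fun s => ρ s - ρ 0) := by
    intro a b
    simpa [edist_dist, Real.dist_eq] using hK a b
  have h2 := h1.comp_memLp (by simp) (Lp.memLp w)
  have h3 := h2.add (memLp_const (ρ 0))
  refine h3.ae_eq (Filter.Eventually.of_forall fun x => ?_)
  simp

/-- The superposition operator `L_2(Ω) → L_2(Ω)`, `w ↦ ρ(w) = ρ ∘ w`, of a Lipschitz function `ρ`
on a bounded domain. -/
def superpos {d : ℕ} {Ω : Set (Space d)} (hΩ : Bornology.IsBounded Ω) {ρ : ℝ → ℝ}
    (hρ : ∃ K : ℝ≥0, LipschitzWith K ρ) (w : L2 Ω) : L2 Ω :=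
  (memLp_comp hΩ hρ w).toLp

namespace ProblemData

/-- The element `ρ(w)` of `L_2(Ω)`. -/
def rho {d : ℕ} (P : ProblemData d) (w : L2 P.Ω) : L2 P.Ω :=
  superpos P.bounded P.ρ_lipschitz w

/-- The element `γ(w)` of `L_2(Ω)`. -/
def gam {d : ℕ} (P : ProblemData d) (w : L2 P.Ω) : L2 P.Ω :=
  superpos P.bounded P.γ_lipschitz w

/-- The vector field `κ∇u + qβ`: `κ` acts pointwise almost everywhere on `∇u`, and
`qβ` is `x ↦ q(x) β`. -/
def flux {d : ℕ} (P : ProblemData d) (u : H10 P.Ω) (q : L2 P.Ω) : L2Vec P.Ω :=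
  (ContinuousLinearMap.id ℝ (Space d →L[ℝ] Space d)).holder 2 P.κ (H10.grad u) +
    (ContinuousLinearMap.toSpanSingleton ℝ P.β).compLp q

/-- `u ∈ H^1_0(Ω)` solves `-div(κ∇u + ρ(u)β) + γ(u) = f` in `Ω` in the distributional sense,
that is, the weak divergence of `κ∇u + ρ(u)β` is `γ(u) - f`. -/
def IsSolution {d : ℕ} (P : ProblemData d) (f : L2 P.Ω) (u : H10 P.Ω) : Prop :=
  IsWeakDiv (P.flux u (P.rho (H10.val u))) (P.gam (H10.val u) - f)

/-- For a solution `u`, the vector field `κ∇u + ρ(u)β` as element of `H(div, Ω)`. -/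
def IsSolution.fluxDiv {d : ℕ} {P : ProblemData d} {f : L2 P.Ω} {u : H10 P.Ω}
    (hu : P.IsSolution f u) : Hdiv P.Ω :=
  ⟨WithLp.toLp 2 (P.flux u (P.rho (H10.val u)), P.gam (H10.val u) - f), hu⟩

/-- The quadruple `𝐮 = (u, σ̂, q, r) ∈ U` of a solution `u`, with `σ̂ = tr_n(κ∇u + ρ(u)β)`,
`q = ρ(u)` and `r = γ(u)`. -/
def IsSolution.extended {d : ℕ} {P : ProblemData d} {f : L2 P.Ω} {u : H10 P.Ω}
    (hu : P.IsSolution f u) (𝒯 : Triangulation P.Ω) : U 𝒯 :=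
  (u, ⟨trn 𝒯 hu.fluxDiv, LinearMap.mem_range_self _ _⟩, P.rho (H10.val u), P.gam (H10.val u))

/-- The operator `B : U → V^*`,
`b(u, σ̂, q, r; v) = (κ∇u + qβ, ∇v)_𝒯 - ⟨σ̂, v⟩_𝒮 + (r, v)`. -/
def B {d : ℕ} (P : ProblemData d) (𝒯 : Triangulation P.Ω) (w : U 𝒯) : V 𝒯 →L[ℝ] ℝ :=
  (innerSL ℝ (P.flux w.1 w.2.2.1)).comp (V.grad 𝒯) - w.2.1.1 +
    (innerSL ℝ w.2.2.2).comp (V.val 𝒯)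

end ProblemData

/-- The functional `L(v) = (f, v)` on `V`. -/
def load {d : ℕ} {Ω : Set (Space d)} (𝒯 : Triangulation Ω) (f : L2 Ω) : V 𝒯 →L[ℝ] ℝ :=
  (innerSL ℝ f).comp (V.val 𝒯)

/-- The discrete dual norm `‖F‖_{V_h^*}` of `F ∈ V^*`: operator norm of the restriction of `F` to
the subspace `V_h` of `V`. -/
def discreteDualNorm {d : ℕ} {Ω : Set (Space d)} {𝒯 : Triangulation Ω}
    (Vh : Submodule ℝ (V 𝒯)) (F : V 𝒯 →L[ℝ] ℝ) : ℝ :=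
  ‖F.comp Vh.subtypeL‖

namespace ProblemData

/-- The discrete minimum residual functional
`‖B𝐰 - L‖_{V_h^*}² + ‖ρ(w) - s‖² + ‖γ(w) - t‖²`, `𝐰 = (w, τ̂, s, t)`. -/
def residual {d : ℕ} (P : ProblemData d) (f : L2 P.Ω) {𝒯 : Triangulation P.Ω}
    (Vh : Submodule ℝ (V 𝒯)) (w : U 𝒯) : ℝ :=
  discreteDualNorm Vh (P.B 𝒯 w - load 𝒯 f) ^ 2 +
    ‖P.rho (H10.val w.1) - w.2.2.1‖ ^ 2 + ‖P.gam (H10.val w.1) - w.2.2.2‖ ^ 2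

/-- `𝐮_h ∈ U_h` minimizes the discrete minimum residual functional over `U_h`. -/
def IsDiscreteMinimizer {d : ℕ} (P : ProblemData d) (f : L2 P.Ω) {𝒯 : Triangulation P.Ω}
    (Uh : Submodule ℝ (U 𝒯)) (Vh : Submodule ℝ (V 𝒯)) (uh : U 𝒯) : Prop :=
  uh ∈ Uh ∧ ∀ wh ∈ Uh, P.residual f Vh uh ≤ P.residual f Vh wh

/-- `Π_F : V → V_h` is a Fortin operator with constant `C_F`: `‖Π_F v‖_V ≤ C_F ‖v‖_V` and
`b(𝐮_h, v - Π_F v) = 0` for all `v ∈ V`, `𝐮_h ∈ U_h`. Linearity of `Π_F` is not required. -/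
def IsFortin {d : ℕ} (P : ProblemData d) {𝒯 : Triangulation P.Ω}
    (Uh : Submodule ℝ (U 𝒯)) (Vh : Submodule ℝ (V 𝒯)) (CF : ℝ) (PiF : V 𝒯 → Vh) : Prop :=
  ∀ v : V 𝒯, ‖PiF v‖ ≤ CF * ‖v‖ ∧ ∀ uh ∈ Uh, P.B 𝒯 uh (v - PiF v) = 0

end ProblemData

end SemilinearDPG

end

open SemilinearDPG Filter Topology

/-! Since the exact quadruple satisfies `B𝐮 = L`, `q = ρ(u)` and `r = γ(u)`, the residual at any
`𝐰_h ∈ U_h` is at most `(A N)²` with `N = ‖𝐮 - 𝐰_h‖_U`, by boundedness of `B`, Lipschitz continuity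
and the Poincaré–Friedrichs inequality (`exists_residual_le`). The minimizer has no larger residual.
The Fortin operator upgrades the discrete dual norm to the norm of `V^*` on `U_h`, so `‖B(𝐮 -
𝐮_h)‖_{V^*}` is bounded by a multiple of `N`; the defects `ρ(u_h) - q_h` and `γ(u_h) - r_h` are
bounded likewise (`exists_minimizer_bounds`).

It remains to recover the error from these bounds. Testing `B(𝐮 - 𝐮_h)` with `u - u_h ∈ H^1_0(Ω)`
removes the trace, and ellipticity of `κ` bounds the gradient error up to the `L_2` errors of the
other components (`norm_grad_sq_le`). Through the Lipschitz constants these cost a multiple of `‖u -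
u_h‖` plus a multiple of `N`. For small `h`, the hypothesis `‖u - u_h‖ ≤ c(h) ‖∇(u - u_h)‖` lets the
left side absorb the former (`exists_quasi_optimality_constant`); no monotonicity of the nonlinear
problem enters.

The trace error follows from `B` and the other components, because the trace norm is dominated by
the dual norm of `H^1(𝒯)` with constant one (`traceNorm_le_norm`). Hence no constant depends on the
mesh. -/

noncomputable section

namespace SemilinearDPG

open MeasureTheory Set Filter Topology
open scoped ENNReal NNReal ContDiff RealInnerProductSpace

variable {d : ℕ} {Ω : Set (Space d)}

/-! ### Test functions and their density in `H^1_0(Ω)` -/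

section TestFunctions

/-- The class in `L_2(Ω)` of a test function. -/
def IsTestFunction.toL2 {G : Set (Space d)} {φ : Space d → ℝ} (h : IsTestFunction G φ)
    (Ω : Set (Space d)) : L2 Ω :=
  (h.memLp (Ω := Ω)).toLp

/-- The class in `L_2(Ω; ℝ^d)` of the gradient of a test function. -/
def IsTestFunction.gradL2 {G : Set (Space d)} {φ : Space d → ℝ} (h : IsTestFunction G φ)
    (Ω : Set (Space d)) : L2Vec Ω :=
  (h.memLp_gradient (Ω := Ω)).toLp

/-- The pair of a test function and its gradient. -/
def IsTestFunction.pair {G : Set (Space d)} {φ : Space d → ℝ} (h : IsTestFunction G φ)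
    (Ω : Set (Space d)) : WithLp 2 (L2 Ω × L2Vec Ω) :=
  WithLp.toLp 2 (h.toL2 Ω, h.gradL2 Ω)

theorem IsTestFunction.differentiable {G : Set (Space d)} {φ : Space d → ℝ}
    (h : IsTestFunction G φ) : Differentiable ℝ φ :=
  h.smooth.differentiable (by simp)

theorem IsTestFunction.zero (G : Set (Space d)) : IsTestFunction G (fun _ => (0 : ℝ)) where
  smooth := contDiff_const
  compact := HasCompactSupport.zero
  supp := by
    have : tsupport (fun _ : Space d => (0 : ℝ)) = ∅ := tsupport_eq_empty_iff.2 rfl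
    simp [this]

theorem IsTestFunction.add {G : Set (Space d)} {φ ψ : Space d → ℝ} (h : IsTestFunction G φ)
    (h' : IsTestFunction G ψ) : IsTestFunction G (φ + ψ) where
  smooth := h.smooth.add h'.smooth
  compact := h.compact.add h'.compact
  supp := (tsupport_add φ ψ).trans (union_subset h.supp h'.supp)

theorem IsTestFunction.smul {G : Set (Space d)} {φ : Space d → ℝ} (c : ℝ)
    (h : IsTestFunction G φ) : IsTestFunction G (c • φ) where
  smooth := h.smooth.const_smul c
  compact := h.compact.smul_left (f := fun _ => c)
  supp := (tsupport_smul_subset_right (fun _ => c) φ).trans h.supp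

theorem inner_gradient_eq_fderiv (φ : Space d → ℝ) (x ξ : Space d) :
    ⟪gradient φ x, ξ⟫ = fderiv ℝ φ x ξ := by
  rw [gradient, InnerProductSpace.toDual_symm_apply]

theorem norm_gradient_eq_norm_fderiv (φ : Space d → ℝ) (x : Space d) :
    ‖gradient φ x‖ = ‖fderiv ℝ φ x‖ := by
  rw [gradient, LinearIsometryEquiv.norm_map]

theorem IsTestFunction.pair_add {G : Set (Space d)} {φ ψ : Space d → ℝ} (h : IsTestFunction G φ)
    (h' : IsTestFunction G ψ) : (h.add h').pair Ω = h.pair Ω + h'.pair Ω := by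
  have e : gradient (φ + ψ) = gradient φ + gradient ψ := by
    funext x
    simp [gradient, fderiv_add (h.differentiable x) (h'.differentiable x)]
  have e1 : (h.add h').toL2 Ω = h.toL2 Ω + h'.toL2 Ω := MemLp.toLp_add _ _
  have e2 : (h.add h').gradL2 Ω = h.gradL2 Ω + h'.gradL2 Ω := by
    rw [IsTestFunction.gradL2, IsTestFunction.gradL2, IsTestFunction.gradL2, ← MemLp.toLp_add]
    simp [e]
  simp only [IsTestFunction.pair, e1, e2]
  rfl

theorem IsTestFunction.pair_smul {G : Set (Space d)} {φ : Space d → ℝ} (c : ℝ)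
    (h : IsTestFunction G φ) : (h.smul c).pair Ω = c • h.pair Ω := by
  have e : gradient (c • φ) = c • gradient φ := by
    funext x
    simp [gradient, fderiv_const_smul (h.differentiable x)]
  have e1 : (h.smul c).toL2 Ω = c • h.toL2 Ω := MemLp.toLp_const_smul _ _
  have e2 : (h.smul c).gradL2 Ω = c • h.gradL2 Ω := by
    rw [IsTestFunction.gradL2, IsTestFunction.gradL2, ← MemLp.toLp_const_smul]
    simp [e]
  simp only [IsTestFunction.pair, e1, e2]
  rfl

theorem IsTestFunction.pair_zero (G : Set (Space d)) :
    (IsTestFunction.zero G).pair Ω = 0 := by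
  have e1 : (IsTestFunction.zero G).toL2 Ω = 0 := MemLp.toLp_zero _
  have e2 : (IsTestFunction.zero G).gradL2 Ω = 0 := by
    have e : gradient (fun _ : Space d => (0 : ℝ)) = 0 := by
      funext x
      simp [gradient]
    simp [IsTestFunction.gradL2, e]
  rw [IsTestFunction.pair, e1, e2]
  rfl

theorem IsTestFunction.eq_pair {G : Set (Space d)} {φ : Space d → ℝ} (h : IsTestFunction G φ)
    {x : WithLp 2 (L2 Ω × L2Vec Ω)} (h1 : x.fst =ᵐ[volume.restrict Ω] φ)
    (h2 : x.snd =ᵐ[volume.restrict Ω] gradient φ) : x = h.pair Ω := by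
  have e1 : x.fst = h.toL2 Ω := Lp.ext (h1.trans (MemLp.coeFn_toLp _).symm)
  have e2 : x.snd = h.gradL2 Ω := Lp.ext (h2.trans (MemLp.coeFn_toLp _).symm)
  rw [IsTestFunction.pair, ← e1, ← e2]
  rfl

/-- A closed set which contains all test functions contains `H^1_0(Ω)`. -/
theorem H10.mem_of_isClosed {S : Set (WithLp 2 (L2 Ω × L2Vec Ω))} (hS : IsClosed S)
    (h : ∀ (φ : Space d → ℝ) (hφ : IsTestFunction Ω φ), hφ.pair Ω ∈ S) (u : H10 Ω) :
    u.1 ∈ S := by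
  refine closure_minimal ?_ hS u.2
  intro x hx
  -- The pairs `(φ, ∇φ)` already form a linear space, so taking the span adds nothing.
  suffices ∃ (φ : Space d → ℝ) (hφ : IsTestFunction Ω φ), x = hφ.pair Ω by
    obtain ⟨φ, hφ, rfl⟩ := this
    exact h φ hφ
  induction hx using Submodule.span_induction with
  | mem x hx =>
    obtain ⟨φ, hφ, h1, h2⟩ := hx
    exact ⟨φ, hφ, hφ.eq_pair h1 h2⟩
  | zero => exact ⟨_, IsTestFunction.zero Ω, (IsTestFunction.pair_zero Ω).symm⟩
  | add x y _ _ hx hy =>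
    obtain ⟨φ, hφ, rfl⟩ := hx
    obtain ⟨ψ, hψ, rfl⟩ := hy
    exact ⟨_, hφ.add hψ, (hφ.pair_add hψ).symm⟩
  | smul c x _ hx =>
    obtain ⟨φ, hφ, rfl⟩ := hx
    exact ⟨_, hφ.smul c, (hφ.pair_smul c).symm⟩

end TestFunctions

/-! ### Weak derivatives, completeness of `H^1(𝒯)`, and integration by parts -/

section WeakDerivatives

/-- In this form the condition is a family of continuous linear equations, accessible to density
arguments and to Riesz representation. -/
theorem isWeakDiv_iff_inner (τ : L2Vec Ω) (δ : L2 Ω) :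
    IsWeakDiv τ δ ↔ ∀ (φ : Space d → ℝ) (hφ : IsTestFunction Ω φ),
      ⟪hφ.toL2 Ω, δ⟫ + ⟪hφ.gradL2 Ω, τ⟫ = 0 := by
  refine forall₂_congr fun φ hφ => ?_
  have e1 : ⟪hφ.gradL2 Ω, τ⟫ = ∫ x in Ω, ⟪τ x, gradient φ x⟫ := by
    rw [L2.inner_def]
    refine integral_congr_ae ?_
    filter_upwards [(hφ.memLp_gradient (Ω := Ω)).coeFn_toLp] with x hx
    rw [IsTestFunction.gradL2, hx, real_inner_comm]
  have e2 : ⟪hφ.toL2 Ω, δ⟫ = ∫ x in Ω, φ x * δ x := by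
    rw [L2.inner_def]
    refine integral_congr_ae ?_
    filter_upwards [(hφ.memLp (Ω := Ω)).coeFn_toLp] with x hx
    rw [IsTestFunction.toL2, hx]
    simp [mul_comm]
  rw [e1, e2]
  constructor <;> intro h <;> linarith

theorem IsTestFunction.memLp_inner_gradient {G : Set (Space d)} {φ : Space d → ℝ}
    (h : IsTestFunction G φ) (ξ : Space d) :
    MemLp (fun x => ⟪ξ, gradient φ x⟫) 2 (volume.restrict Ω) :=
  (h.memLp_gradient (Ω := Ω)).const_inner ξ

theorem IsTestFunction.memLp_smul_const {G : Set (Space d)} {φ : Space d → ℝ}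
    (h : IsTestFunction G φ) (ξ : Space d) :
    MemLp (fun x => φ x • ξ) 2 (volume.restrict Ω) :=
  ((ContinuousLinearMap.toSpanSingleton ℝ ξ).comp_memLp' (h.memLp (Ω := Ω)))

/-- The vector identity is tested against each direction `ξ`, which turns it into scalar equations
that are continuous in `(v, g)`. -/
theorem isWeakGradOn_iff_inner {G : Set (Space d)} (v : L2 Ω) (g : L2Vec Ω) :
    IsWeakGradOn G v g ↔ ∀ (φ : Space d → ℝ) (hφ : IsTestFunction G φ) (ξ : Space d),
      ⟪((hφ.memLp_inner_gradient ξ).toLp : L2 Ω), v⟫ +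
        ⟪((hφ.memLp_smul_const ξ).toLp : L2Vec Ω), g⟫ = 0 := by
  refine forall₂_congr fun φ hφ => ?_
  have i1 : Integrable (fun z => v z • gradient φ z) (volume.restrict Ω) :=
    memLp_one_iff_integrable.1 ((hφ.memLp_gradient (Ω := Ω)).smul (Lp.memLp v))
  have i2 : Integrable (fun z => φ z • g z) (volume.restrict Ω) :=
    memLp_one_iff_integrable.1 ((Lp.memLp g).smul (hφ.memLp (Ω := Ω)))
  have e1 (ξ : Space d) : ⟪((hφ.memLp_inner_gradient ξ).toLp : L2 Ω), v⟫ =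
      ⟪ξ, ∫ x in Ω, v x • gradient φ x⟫ := by
    rw [L2.inner_def, ← integral_inner i1]
    refine integral_congr_ae ?_
    filter_upwards [(hφ.memLp_inner_gradient (Ω := Ω) ξ).coeFn_toLp] with x hx
    rw [hx, inner_smul_right]
    simp
  have e2 (ξ : Space d) : ⟪((hφ.memLp_smul_const ξ).toLp : L2Vec Ω), g⟫ =
      ⟪ξ, ∫ x in Ω, φ x • g x⟫ := by
    rw [L2.inner_def, ← integral_inner i2]
    refine integral_congr_ae ?_
    filter_upwards [(hφ.memLp_smul_const (Ω := Ω) ξ).coeFn_toLp] with x hx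
    rw [hx, inner_smul_right, real_inner_smul_left]
  simp only [e1, e2, ← inner_add_right]
  rw [← add_eq_zero_iff_eq_neg]
  exact ⟨fun h ξ => by rw [h, inner_zero_right], fun h => ext_inner_left ℝ fun ξ => by
    rw [h, inner_zero_right]⟩

theorem Triangulation.subset_of_mem_elements (𝒯 : Triangulation Ω) {T : Set (Space d)}
    (hT : T ∈ 𝒯.elements) : T ⊆ Ω := by
  obtain ⟨s, hs, rfl⟩ := hT
  exact 𝒯.interior_subset s hs

/-- Closedness makes `V` a Hilbert space, as the Riesz representation in `traceNorm_le_norm`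
requires. -/
theorem V.isClosed (𝒯 : Triangulation Ω) :
    IsClosed (V 𝒯 : Set (WithLp 2 (L2 Ω × L2Vec Ω))) := by
  have : (V 𝒯 : Set (WithLp 2 (L2 Ω × L2Vec Ω))) =
      {x | ∀ T ∈ 𝒯.elements, IsWeakGradOn T x.fst x.snd} := rfl
  simp only [this, isWeakGradOn_iff_inner, ofPred_forall]
  refine isClosed_iInter fun T => isClosed_iInter fun _ => isClosed_iInter fun φ =>
    isClosed_iInter fun hφ => isClosed_iInter fun ξ => isClosed_eq ?_ continuous_const
  exact (continuous_const.inner (WithLp.fstL 2 ℝ (L2 Ω) (L2Vec Ω)).continuous).add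
    (continuous_const.inner (WithLp.sndL 2 ℝ (L2 Ω) (L2Vec Ω)).continuous)

instance (𝒯 : Triangulation Ω) : CompleteSpace (V 𝒯) :=
  (V.isClosed 𝒯).completeSpace_coe

theorem IsTestFunction.isWeakGradOn_pair {φ : Space d → ℝ} (hφ : IsTestFunction Ω φ)
    {G : Set (Space d)} (hG : G ⊆ Ω) :
    IsWeakGradOn G (hφ.pair Ω).fst (hφ.pair Ω).snd := by
  rw [isWeakGradOn_iff_inner]
  intro ψ hψ ξ
  -- Both integrals extend to the whole space, where integration by parts has no boundary term.
  have hψ0 : ∀ x, x ∉ Ω → ψ x = 0 ∧ fderiv ℝ ψ x = 0 := by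
    intro x hx
    have hx' : x ∉ tsupport ψ := fun h => hx (hG (hψ.supp h))
    refine ⟨image_eq_zero_of_notMem_tsupport hx', ?_⟩
    exact image_eq_zero_of_notMem_tsupport fun h => hx' (tsupport_fderiv_subset ℝ h)
  have e1 : ⟪((hψ.memLp_inner_gradient ξ).toLp : L2 Ω), hφ.toL2 Ω⟫ =
      ∫ x, φ x * fderiv ℝ ψ x ξ := by
    rw [← setIntegral_eq_integral_of_forall_compl_eq_zero (s := Ω)
      (fun x hx => by simp [(hψ0 x hx).2]), L2.inner_def]
    refine integral_congr_ae ?_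
    filter_upwards [(hψ.memLp_inner_gradient (Ω := Ω) ξ).coeFn_toLp,
      (hφ.memLp (Ω := Ω)).coeFn_toLp] with x hx hx'
    rw [hx, IsTestFunction.toL2, hx', ← real_inner_comm ξ (gradient ψ x), inner_gradient_eq_fderiv]
    simp
  have e2 : ⟪((hψ.memLp_smul_const ξ).toLp : L2Vec Ω), hφ.gradL2 Ω⟫ =
      ∫ x, fderiv ℝ φ x ξ * ψ x := by
    rw [← setIntegral_eq_integral_of_forall_compl_eq_zero (s := Ω)
      (fun x hx => by simp [(hψ0 x hx).1]), L2.inner_def]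
    refine integral_congr_ae ?_
    filter_upwards [(hψ.memLp_smul_const (Ω := Ω) ξ).coeFn_toLp,
      (hφ.memLp_gradient (Ω := Ω)).coeFn_toLp] with x hx hx'
    rw [hx, IsTestFunction.gradL2, hx', real_inner_smul_left, real_inner_comm,
      inner_gradient_eq_fderiv, mul_comm]
  have c1 : Continuous fun x => fderiv ℝ φ x ξ :=
    (hφ.smooth.continuous_fderiv (by simp)).clm_apply continuous_const
  have c2 : Continuous fun x => fderiv ℝ ψ x ξ :=
    (hψ.smooth.continuous_fderiv (by simp)).clm_apply continuous_const
  have ibp := integral_mul_fderiv_eq_neg_fderiv_mul_of_integrable (μ := volume)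
    (f := φ) (g := ψ) (v := ξ)
    ((c1.mul hψ.smooth.continuous).integrable_of_hasCompactSupport hψ.compact.mul_left)
    ((hφ.smooth.continuous.mul c2).integrable_of_hasCompactSupport hφ.compact.mul_right)
    ((hφ.smooth.continuous.mul hψ.smooth.continuous).integrable_of_hasCompactSupport
      hψ.compact.mul_left)
    (fun x _ => hφ.differentiable x) (fun x _ => hψ.differentiable x)
  have e3 : (hφ.pair Ω).fst = hφ.toL2 Ω := rfl
  have e4 : (hφ.pair Ω).snd = hφ.gradL2 Ω := rfl
  rw [e3, e4, e1, e2, ibp, neg_add_cancel]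

theorem H10.mem_V (𝒯 : Triangulation Ω) (u : H10 Ω) : u.1 ∈ V 𝒯 :=
  H10.mem_of_isClosed (V.isClosed 𝒯)
    (fun _ hφ _ hT => hφ.isWeakGradOn_pair (𝒯.subset_of_mem_elements hT)) u

/-- The embedding of `H^1_0(Ω)` into `H^1(𝒯)`. -/
def H10.toV (𝒯 : Triangulation Ω) (u : H10 Ω) : V 𝒯 := ⟨u.1, H10.mem_V 𝒯 u⟩

/-- For test functions this is the definition of the weak divergence; both sides are continuous on
the closure. -/
theorem Hdiv.inner_H10 (τ : Hdiv Ω) (u : H10 Ω) :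
    ⟪H10.val u, τ.1.snd⟫ + ⟪H10.grad u, τ.1.fst⟫ = 0 := by
  refine H10.mem_of_isClosed (S := {x | ⟪x.fst, τ.1.snd⟫ + ⟪x.snd, τ.1.fst⟫ = 0}) ?_ ?_ u
  · refine isClosed_eq ?_ continuous_const
    exact ((WithLp.fstL 2 ℝ (L2 Ω) (L2Vec Ω)).continuous.inner continuous_const).add
      ((WithLp.sndL 2 ℝ (L2 Ω) (L2Vec Ω)).continuous.inner continuous_const)
  · intro φ hφ
    exact (isWeakDiv_iff_inner _ _).1 τ.2 φ hφ

end WeakDerivatives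

/-! ### The Poincaré–Friedrichs inequality -/

section Friedrichs

/-- The Gagliardo–Nirenberg–Sobolev inequality bounds the `L_2` norm by the `L_p` norm of the
gradient for some `p < 2`; Hölder on the bounded set `Ω` then passes from `L_p` to `L_2`. -/
theorem IsTestFunction.eLpNorm_le {Ω : Set (Space d)} (hd : d = 2 ∨ d = 3)
    (hΩ : Bornology.IsBounded Ω) :
    ∃ C : ℝ≥0, ∀ (φ : Space d → ℝ), IsTestFunction Ω φ →
      eLpNorm φ 2 (volume.restrict Ω) ≤ C * eLpNorm (gradient φ) 2 (volume.restrict Ω) := by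
  have hμ : volume Ω ≠ ⊤ := hΩ.measure_lt_top.ne
  -- One exponent serves both dimensions: `1 ≤ p < d` and `1/p - 1/d ≤ 1/2`. The choice `p = 2`
  -- would violate `p < d` for `d = 2`.
  let p : ℝ≥0 := 3 / 2
  let K := eLpNormLESNormFDerivOfLeConst ℝ (volume : Measure (Space d)) Ω p 2
  let m : ℝ≥0∞ := volume Ω ^ (1 / (p : ℝ≥0∞).toReal - 1 / (2 : ℝ≥0∞).toReal)
  have hp : (p : ℝ≥0∞).toReal = 3 / 2 := by simp [p]
  have hm : m ≠ ⊤ := ENNReal.rpow_ne_top_of_nonneg (by rw [hp]; norm_num) hμ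
  refine ⟨K * m.toNNReal, fun φ hφ => ?_⟩
  have hd' : (2 : ℝ) ≤ d := by rcases hd with rfl | rfl <;> norm_num
  have gns : eLpNorm φ (2 : ℝ≥0) volume ≤ K * eLpNorm (fderiv ℝ φ) p volume := by
    refine eLpNorm_le_eLpNorm_fderiv_of_le volume (hφ.smooth.of_le (by simp))
      ((subset_tsupport φ).trans hφ.supp) (p := p) (q := 2) ?_ ?_ ?_ hΩ
    · rw [← NNReal.coe_le_coe]
      norm_num [p]
    · rw [finrank_euclideanSpace_fin, ← NNReal.coe_lt_coe]
      have : ((p : ℝ≥0) : ℝ) = 3 / 2 := by simp [p]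
      rw [this, NNReal.coe_natCast]
      linarith
    · rw [finrank_euclideanSpace_fin]
      have h1 : ((p⁻¹ : ℝ≥0) : ℝ) = 2 / 3 := by simp [p]
      rcases hd with rfl | rfl
      · rw [h1]; norm_num
      · rw [h1]; norm_num
  have hsupp : Function.support (gradient φ) ⊆ Ω := by
    intro x hx
    refine hφ.supp (support_fderiv_subset ℝ ?_)
    rw [Function.mem_support, ← norm_ne_zero_iff] at hx ⊢
    rwa [← norm_gradient_eq_norm_fderiv]
  calc eLpNorm φ 2 (volume.restrict Ω) ≤ eLpNorm φ 2 volume := eLpNorm_restrict_le _ _ _ _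
    _ ≤ K * eLpNorm (fderiv ℝ φ) p volume := gns
    _ = K * eLpNorm (gradient φ) p volume := by
        rw [eLpNorm_congr_norm_ae
          (Eventually.of_forall fun x => (norm_gradient_eq_norm_fderiv φ x).symm)]
    _ = K * eLpNorm (gradient φ) p (volume.restrict Ω) := by
        rw [eLpNorm_restrict_eq_of_support_subset hsupp]
    _ ≤ K * (eLpNorm (gradient φ) 2 (volume.restrict Ω) * m) := by
        gcongr
        have := eLpNorm_le_eLpNorm_mul_rpow_measure_univ (p := p) (q := 2)
          (μ := volume.restrict Ω) ?_ (hφ.memLp_gradient (Ω := Ω)).aestronglyMeasurable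
        · rwa [Measure.restrict_apply_univ] at this
        · have : p ≤ 2 := by rw [← NNReal.coe_le_coe]; norm_num [p]
          exact_mod_cast this
    _ = (K * m.toNNReal : ℝ≥0) * eLpNorm (gradient φ) 2 (volume.restrict Ω) := by
        rw [ENNReal.coe_mul, ENNReal.coe_toNNReal hm]
        ring

/-- The Poincaré–Friedrichs inequality. -/
theorem H10.norm_val_le (hd : d = 2 ∨ d = 3) (hΩ : Bornology.IsBounded Ω) :
    ∃ C : ℝ, 0 ≤ C ∧ ∀ u : H10 Ω, ‖H10.val u‖ ≤ C * ‖H10.grad u‖ := by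
  obtain ⟨C, hC⟩ := IsTestFunction.eLpNorm_le hd hΩ
  refine ⟨C, C.2, fun u => ?_⟩
  refine H10.mem_of_isClosed (S := {x | ‖x.fst‖ ≤ C * ‖x.snd‖}) ?_ ?_ u
  · exact isClosed_le (WithLp.fstL 2 ℝ (L2 Ω) (L2Vec Ω)).continuous.norm
      (continuous_const.mul (WithLp.sndL 2 ℝ (L2 Ω) (L2Vec Ω)).continuous.norm)
  · intro φ hφ
    have e3 : (hφ.pair Ω).fst = hφ.toL2 Ω := rfl
    have e4 : (hφ.pair Ω).snd = hφ.gradL2 Ω := rfl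
    rw [mem_ofPred_eq, e3, e4, IsTestFunction.toL2, IsTestFunction.gradL2, Lp.norm_toLp,
      Lp.norm_toLp]
    have := ENNReal.toReal_mono
      (ENNReal.mul_ne_top ENNReal.coe_ne_top (hφ.memLp_gradient (Ω := Ω)).eLpNorm_ne_top)
      (hC φ hφ)
    rwa [ENNReal.toReal_mul] at this

end Friedrichs

/-! ### The trace norm as a dual norm -/

section Traces

variable {𝒯 : Triangulation Ω}

theorem V.norm_val_le (v : V 𝒯) : ‖V.val 𝒯 v‖ ≤ ‖v‖ := by
  rw [← sq_le_sq₀ (norm_nonneg _) (norm_nonneg _), Submodule.coe_norm,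
    WithLp.prod_norm_sq_eq_of_L2]
  exact le_add_of_nonneg_right (sq_nonneg _)

theorem V.norm_grad_le (v : V 𝒯) : ‖V.grad 𝒯 v‖ ≤ ‖v‖ := by
  rw [← sq_le_sq₀ (norm_nonneg _) (norm_nonneg _), Submodule.coe_norm,
    WithLp.prod_norm_sq_eq_of_L2]
  exact le_add_of_nonneg_left (sq_nonneg _)

theorem V.inner_eq (v w : V 𝒯) :
    ⟪v, w⟫ = ⟪V.val 𝒯 v, V.val 𝒯 w⟫ + ⟪V.grad 𝒯 v, V.grad 𝒯 w⟫ := by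
  rw [Submodule.coe_inner, WithLp.prod_inner_apply]
  rfl

theorem trn_apply (τ : Hdiv Ω) (v : V 𝒯) :
    trn 𝒯 τ v = ⟪τ.1.snd, V.val 𝒯 v⟫ + ⟪τ.1.fst, V.grad 𝒯 v⟫ := rfl

theorem norm_trn_le (τ : Hdiv Ω) : ‖trn 𝒯 τ‖ ≤ ‖τ‖ := by
  refine ContinuousLinearMap.opNorm_le_bound _ (norm_nonneg _) fun v => ?_
  -- With the components swapped, the trace is the inner product of `(div τ, τ)` with `(v, ∇v)`, and
  -- Cauchy–Schwarz gives the constant one.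
  let x : WithLp 2 (L2 Ω × L2Vec Ω) := WithLp.toLp 2 (τ.1.snd, τ.1.fst)
  have e : trn 𝒯 τ v = ⟪x, v.1⟫ := rfl
  have hx : ‖x‖ = ‖τ‖ := by
    rw [Submodule.coe_norm, ← sq_eq_sq₀ (norm_nonneg _) (norm_nonneg _),
      WithLp.prod_norm_sq_eq_of_L2, WithLp.prod_norm_sq_eq_of_L2, add_comm]
    rfl
  rw [e, ← hx]
  exact norm_inner_le_norm x v.1

/-- On `H^1_0(Ω)` the elementwise pairing is the global integration by parts formula. This is what
eliminates the trace when `B` is tested with the first component. -/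
theorem TraceSpace.apply_H10 (σ : TraceSpace 𝒯) (u : H10 Ω) : σ.1 (H10.toV 𝒯 u) = 0 := by
  obtain ⟨τ, hτ⟩ := σ.2
  rw [← hτ, trn_apply, real_inner_comm, real_inner_comm (V.grad 𝒯 _)]
  exact Hdiv.inner_H10 τ u

theorem traceNorm_nonneg (σ : TraceSpace 𝒯) : 0 ≤ traceNorm σ := by
  refine Real.sInf_nonneg ?_
  rintro _ ⟨τ, _, rfl⟩
  exact norm_nonneg _

theorem norm_le_traceNorm (σ : TraceSpace 𝒯) : ‖σ.1‖ ≤ traceNorm σ := by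
  obtain ⟨τ, hτ⟩ := σ.2
  refine le_csInf ⟨_, τ, hτ, rfl⟩ ?_
  rintro _ ⟨τ', h, rfl⟩
  rw [← h]
  exact norm_trn_le τ'

/-- The trace norm is bounded by the norm of `H^1(𝒯)^*`: if `v` is the Riesz representative of a
trace, then the vector field `∇v` has divergence `v` and the given trace. -/
theorem traceNorm_le_norm (σ : TraceSpace 𝒯) : traceNorm σ ≤ ‖σ.1‖ := by
  let v : V 𝒯 := (InnerProductSpace.toDual ℝ (V 𝒯)).symm σ.1
  have hv (w : V 𝒯) : ⟪v, w⟫ = σ.1 w := InnerProductSpace.toDual_symm_apply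
  have hnorm : ‖v‖ = ‖σ.1‖ := LinearIsometryEquiv.norm_map _ _
  -- Traces vanish on `H^1_0(Ω)`, so `v` is orthogonal to every test function in `H^1(𝒯)`: `(v, φ) +
  -- (∇v, ∇φ) = 0`.
  have hdiv : IsWeakDiv (V.grad 𝒯 v) (V.val 𝒯 v) := by
    rw [isWeakDiv_iff_inner]
    intro φ hφ
    have hmem : hφ.pair Ω ∈ H10 Ω :=
      Submodule.le_topologicalClosure _ (Submodule.subset_span
        ⟨φ, hφ, hφ.memLp.coeFn_toLp, hφ.memLp_gradient.coeFn_toLp⟩)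
    have h1 := hv (H10.toV 𝒯 ⟨_, hmem⟩)
    rw [TraceSpace.apply_H10, real_inner_comm, V.inner_eq] at h1
    exact h1
  let τ : Hdiv Ω := ⟨WithLp.toLp 2 (V.grad 𝒯 v, V.val 𝒯 v), hdiv⟩
  have hτ : trn 𝒯 τ = σ.1 := by
    ext w
    rw [← hv w, V.inner_eq]
    rfl
  have hτn : ‖τ‖ = ‖v‖ := by
    rw [Submodule.coe_norm, Submodule.coe_norm, ← sq_eq_sq₀ (norm_nonneg _) (norm_nonneg _),
      WithLp.prod_norm_sq_eq_of_L2, WithLp.prod_norm_sq_eq_of_L2, add_comm]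
    rfl
  rw [← hnorm, ← hτn]
  refine csInf_le ⟨0, ?_⟩ ⟨τ, hτ, rfl⟩
  rintro _ ⟨τ', _, rfl⟩
  exact norm_nonneg _

end Traces

/-! ### Absorption of the lower order terms -/

/-- The arithmetic of the quasi-optimality proof: a Gårding-type inequality for the gradient error
`E`, whose lower order terms are absorbed if the `L_2` error `v` is small compared to `E`. -/
theorem exists_quasi_optimality_constant {κ₀ M β Kρ Kγ A : ℝ} (hκ₀ : 0 < κ₀) (hM : 0 ≤ M)
    (hβ : 0 ≤ β) (hρ0 : 0 ≤ Kρ) (hγ0 : 0 ≤ Kγ) (hA : 0 < A) :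
    ∃ C ε : ℝ, 0 < C ∧ 0 < ε ∧ ∀ {N E v s t σ b : ℝ}, 0 ≤ N → 0 ≤ E → 0 ≤ v → v ≤ ε * E →
      b ≤ A * N → s ≤ Kρ * v + A * N → t ≤ Kγ * v + A * N →
      κ₀ * E ^ 2 ≤ b * (v + E) + β * s * E + t * v → σ ≤ b + M * E + β * s + t →
      E + σ + s + t ≤ C * N := by
  -- `D` collects the Lipschitz contributions to be absorbed. `G`, `S`, `T`, `R` are the final
  -- factors of `N` in the bounds of `E`, `s`, `t`, `σ`.
  let D : ℝ := β * Kρ + Kγ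
  let G : ℝ := 2 / κ₀ * ((3 + β) * A)
  let S : ℝ := Kρ * G + A
  let T : ℝ := Kγ * G + A
  let R : ℝ := A + M * G + β * S + T
  have hD : 0 ≤ D := by positivity
  have hG : 0 < G := by positivity
  have hS : 0 < S := by positivity
  have hT : 0 < T := by positivity
  have hR : 0 < R := by positivity
  -- The bound by `1` gives `v ≤ E`; the other one makes the absorbed terms cost at most half of
  -- `κ₀`. The summand `1` in `D + 1` covers `D = 0`.
  let ε : ℝ := min 1 (κ₀ / (2 * (D + 1)))
  have hε : 0 < ε := by positivity
  have hε1 : ε ≤ 1 := min_le_left _ _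
  have hεD : ε * D ≤ κ₀ / 2 := by
    have h1 : ε * (D + 1) ≤ κ₀ / (2 * (D + 1)) * (D + 1) :=
      mul_le_mul_of_nonneg_right (min_le_right _ _) (by positivity)
    have h2 : κ₀ / (2 * (D + 1)) * (D + 1) = κ₀ / 2 := by field_simp
    linarith
  refine ⟨G + R + S + T, ε, by positivity, hε, ?_⟩
  intro N E v s t σ b hN hE hv hvE hB hs ht hgrad htrace
  have hAN : 0 ≤ A * N := by positivity
  have hvE1 : v ≤ E := hvE.trans (mul_le_of_le_one_left hE hε1)
  have hs' : s ≤ Kρ * (ε * E) + A * N := by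
    linarith [mul_le_mul_of_nonneg_left hvE hρ0]
  have ht' : t ≤ Kγ * (ε * E) + A * N := by
    linarith [mul_le_mul_of_nonneg_left hvE hγ0]
  have hEG : E ≤ G * N := by
    have h1 : b * (v + E) ≤ A * N * (2 * E) :=
      mul_le_mul hB (by linarith) (by positivity) hAN
    have h2 : β * s * E ≤ β * (Kρ * (ε * E) + A * N) * E := by gcongr
    have h3 : t * v ≤ (Kγ * (ε * E) + A * N) * E :=
      mul_le_mul ht' hvE1 hv (by positivity)
    -- In `3 + β`, two units come from `b * (v + E)`, one from `t * v`, and `β` from `β * s * E`.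
    have h4 : κ₀ * E ^ 2 ≤ ((3 + β) * A * N + ε * D * E) * E := by
      calc _ ≤ A * N * (2 * E) + β * (Kρ * (ε * E) + A * N) * E +
            (Kγ * (ε * E) + A * N) * E := by linarith
        _ = _ := by ring
    have h5 : ε * D * E ≤ κ₀ / 2 * E := mul_le_mul_of_nonneg_right hεD hE
    rcases hE.eq_or_lt with h0 | h0
    · rw [← h0]
      positivity
    · have h6 : κ₀ * E ≤ (3 + β) * A * N + ε * D * E := by
        refine le_of_mul_le_mul_right ?_ h0
        linarith
      have h7 : κ₀ / 2 * E ≤ (3 + β) * A * N := by linarith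
      calc E = 2 / κ₀ * (κ₀ / 2 * E) := by field_simp
        _ ≤ 2 / κ₀ * ((3 + β) * A * N) := by gcongr
        _ = G * N := by ring
  have hvG : v ≤ G * N := hvE1.trans hEG
  have hsS : s ≤ S * N := by
    calc s ≤ Kρ * (G * N) + A * N := by linarith [mul_le_mul_of_nonneg_left hvG hρ0]
      _ = S * N := by ring
  have htT : t ≤ T * N := by
    calc t ≤ Kγ * (G * N) + A * N := by linarith [mul_le_mul_of_nonneg_left hvG hγ0]
      _ = T * N := by ring
  have hσR : σ ≤ R * N := by
    calc σ ≤ A * N + M * (G * N) + β * (S * N) + T * N := by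
          linarith [mul_le_mul_of_nonneg_left hEG hM, mul_le_mul_of_nonneg_left hsS hβ]
      _ = R * N := by ring
  calc E + σ + s + t ≤ G * N + R * N + S * N + T * N := by linarith
    _ = (G + R + S + T) * N := by ring

/-! ### Superposition operators, components of the norm of `U`, discrete dual norms -/

section Superposition

variable {d : ℕ} {Ω : Set (Space d)}

theorem norm_superpos_sub_le (hΩ : Bornology.IsBounded Ω) {ρ : ℝ → ℝ}
    (hρ : ∃ K : ℝ≥0, LipschitzWith K ρ) {K : ℝ≥0} (hK : LipschitzWith K ρ) (v w : L2 Ω) :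
    ‖superpos hΩ hρ v - superpos hΩ hρ w‖ ≤ K * ‖v - w‖ := by
  refine Lp.norm_le_mul_norm_of_ae_le_mul ?_
  filter_upwards [Lp.coeFn_sub (superpos hΩ hρ v) (superpos hΩ hρ w), Lp.coeFn_sub v w,
    (memLp_comp hΩ hρ v).coeFn_toLp, (memLp_comp hΩ hρ w).coeFn_toLp] with x h1 h2 h3 h4
  rw [h1, h2, Pi.sub_apply, Pi.sub_apply, superpos, superpos, h3, h4]
  exact hK.norm_sub_le _ _

end Superposition

section NormU

variable {d : ℕ} {Ω : Set (Space d)} {𝒯 : Triangulation Ω}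

theorem norm_grad_le_normU (w : U 𝒯) : ‖H10.grad w.1‖ ≤ normU w := by
  refine Real.le_sqrt_of_sq_le ?_
  nlinarith [sq_nonneg (traceNorm w.2.1), sq_nonneg ‖w.2.2.1‖, sq_nonneg ‖w.2.2.2‖]

theorem traceNorm_le_normU (w : U 𝒯) : traceNorm w.2.1 ≤ normU w := by
  refine Real.le_sqrt_of_sq_le ?_
  nlinarith [sq_nonneg ‖H10.grad w.1‖, sq_nonneg ‖w.2.2.1‖, sq_nonneg ‖w.2.2.2‖]

theorem norm_third_le_normU (w : U 𝒯) : ‖w.2.2.1‖ ≤ normU w := by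
  refine Real.le_sqrt_of_sq_le ?_
  nlinarith [sq_nonneg ‖H10.grad w.1‖, sq_nonneg (traceNorm w.2.1), sq_nonneg ‖w.2.2.2‖]

theorem norm_fourth_le_normU (w : U 𝒯) : ‖w.2.2.2‖ ≤ normU w := by
  refine Real.le_sqrt_of_sq_le ?_
  nlinarith [sq_nonneg ‖H10.grad w.1‖, sq_nonneg (traceNorm w.2.1), sq_nonneg ‖w.2.2.1‖]

theorem normU_le_add (w : U 𝒯) :
    normU w ≤ ‖H10.grad w.1‖ + traceNorm w.2.1 + ‖w.2.2.1‖ + ‖w.2.2.2‖ := by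
  have h1 := norm_nonneg (H10.grad w.1)
  have h2 := traceNorm_nonneg w.2.1
  have h3 := norm_nonneg w.2.2.1
  have h4 := norm_nonneg w.2.2.2
  refine Real.sqrt_le_iff.2 ⟨by positivity, ?_⟩
  nlinarith [mul_nonneg h1 h2, mul_nonneg h1 h3, mul_nonneg h1 h4, mul_nonneg h2 h3,
    mul_nonneg h2 h4, mul_nonneg h3 h4]

end NormU

section DualNorm

variable {d : ℕ} {Ω : Set (Space d)} {𝒯 : Triangulation Ω}

theorem _root_.ContinuousLinearMap.norm_comp_subtypeL_le {E : Type*} [NormedAddCommGroup E]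
    [NormedSpace ℝ E] (S : Submodule ℝ E) (F : E →L[ℝ] ℝ) : ‖F.comp S.subtypeL‖ ≤ ‖F‖ :=
  ContinuousLinearMap.opNorm_le_bound _ (norm_nonneg _) fun v => F.le_opNorm v

theorem _root_.ContinuousLinearMap.norm_sub_comp_subtypeL_le {E : Type*} [NormedAddCommGroup E]
    [NormedSpace ℝ E] (S : Submodule ℝ E) (F G : E →L[ℝ] ℝ) :
    ‖(F - G).comp S.subtypeL‖ ≤ ‖F.comp S.subtypeL‖ + ‖G.comp S.subtypeL‖ := by
  rw [ContinuousLinearMap.sub_comp]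
  exact norm_sub_le (F.comp S.subtypeL) (G.comp S.subtypeL)

theorem _root_.ContinuousLinearMap.abs_apply_le_norm_comp_subtypeL {E : Type*}
    [NormedAddCommGroup E] [NormedSpace ℝ E] (S : Submodule ℝ E) (F : E →L[ℝ] ℝ) (v : S) :
    |F v| ≤ ‖F.comp S.subtypeL‖ * ‖v‖ :=
  (F.comp S.subtypeL).le_opNorm v

theorem _root_.ContinuousLinearMap.norm_comp_subtypeL_nonneg {E : Type*}
    [NormedAddCommGroup E] [NormedSpace ℝ E] (S : Submodule ℝ E) (F : E →L[ℝ] ℝ) :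
    0 ≤ ‖F.comp S.subtypeL‖ :=
  norm_nonneg (F.comp S.subtypeL)

theorem discreteDualNorm_nonneg (Vh : Submodule ℝ (V 𝒯)) (F : V 𝒯 →L[ℝ] ℝ) :
    0 ≤ discreteDualNorm Vh F :=
  ContinuousLinearMap.norm_comp_subtypeL_nonneg Vh F

theorem discreteDualNorm_le_norm (Vh : Submodule ℝ (V 𝒯)) (F : V 𝒯 →L[ℝ] ℝ) :
    discreteDualNorm Vh F ≤ ‖F‖ :=
  ContinuousLinearMap.norm_comp_subtypeL_le Vh F

theorem discreteDualNorm_sub_le (Vh : Submodule ℝ (V 𝒯)) (F G : V 𝒯 →L[ℝ] ℝ) :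
    discreteDualNorm Vh (F - G) ≤ discreteDualNorm Vh F + discreteDualNorm Vh G :=
  ContinuousLinearMap.norm_sub_comp_subtypeL_le Vh F G

theorem abs_apply_le_discreteDualNorm (Vh : Submodule ℝ (V 𝒯)) (F : V 𝒯 →L[ℝ] ℝ) (v : Vh) :
    |F v| ≤ discreteDualNorm Vh F * ‖v‖ :=
  ContinuousLinearMap.abs_apply_le_norm_comp_subtypeL Vh F v

end DualNorm

/-! ### The operator `B`: boundedness, Gårding inequality, Fortin property, consistency -/

namespace ProblemData

variable {d : ℕ} (P : ProblemData d) {𝒯 : Triangulation P.Ω}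

theorem norm_rho_sub_le {K : ℝ≥0} (hK : LipschitzWith K P.ρ) (v w : L2 P.Ω) :
    ‖P.rho v - P.rho w‖ ≤ K * ‖v - w‖ :=
  norm_superpos_sub_le _ _ hK _ _

theorem norm_gam_sub_le {K : ℝ≥0} (hK : LipschitzWith K P.γ) (v w : L2 P.Ω) :
    ‖P.gam v - P.gam w‖ ≤ K * ‖v - w‖ :=
  norm_superpos_sub_le _ _ hK _ _

/-- The vector field `κ∇u`. -/
def diffusion (u : H10 P.Ω) : L2Vec P.Ω :=
  (ContinuousLinearMap.id ℝ (Space d →L[ℝ] Space d)).holder 2 P.κ (H10.grad u)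

/-- The vector field `qβ`. -/
def advection (q : L2 P.Ω) : L2Vec P.Ω :=
  (ContinuousLinearMap.toSpanSingleton ℝ P.β).compLp q

theorem flux_eq (u : H10 P.Ω) (q : L2 P.Ω) : P.flux u q = P.diffusion u + P.advection q := rfl

theorem diffusion_sub (u v : H10 P.Ω) :
    P.diffusion (u - v) = P.diffusion u - P.diffusion v := by
  have h : H10.grad (u - v) = H10.grad u - H10.grad v := rfl
  simp only [diffusion, h]
  exact map_sub ((ContinuousLinearMap.id ℝ (Space d →L[ℝ] Space d)).holderₗ
    (volume.restrict P.Ω) ⊤ 2 2 P.κ) _ _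

theorem advection_sub (q r : L2 P.Ω) : P.advection (q - r) = P.advection q - P.advection r :=
  map_sub ((ContinuousLinearMap.toSpanSingleton ℝ P.β).compLpₗ 2 (volume.restrict P.Ω)) _ _

theorem norm_diffusion_le : ∃ M : ℝ, 0 ≤ M ∧
    ∀ u : H10 P.Ω, ‖P.diffusion u‖ ≤ M * ‖H10.grad u‖ :=
  ⟨‖ContinuousLinearMap.id ℝ (Space d →L[ℝ] Space d)‖ * ‖P.κ‖, by positivity, fun _ =>
    ContinuousLinearMap.norm_holder_apply_apply_le _ _ _⟩

theorem norm_advection_le (q : L2 P.Ω) : ‖P.advection q‖ ≤ ‖P.β‖ * ‖q‖ := by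
  have := (ContinuousLinearMap.toSpanSingleton ℝ P.β).norm_compLp_le q
  rwa [ContinuousLinearMap.norm_toSpanSingleton] at this

theorem le_inner_diffusion {κ₀ : ℝ}
    (hκ : ∀ᵐ x ∂(volume.restrict P.Ω), ∀ ξ : Space d, κ₀ * ‖ξ‖ ^ 2 ≤ ⟪P.κ x ξ, ξ⟫)
    (u : H10 P.Ω) : κ₀ * ‖H10.grad u‖ ^ 2 ≤ ⟪P.diffusion u, H10.grad u⟫ := by
  rw [← real_inner_self_eq_norm_sq, L2.inner_def, L2.inner_def, ← integral_const_mul]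
  refine integral_mono_ae ((L2.integrable_inner _ _).const_mul _) (L2.integrable_inner _ _) ?_
  filter_upwards [hκ, (ContinuousLinearMap.id ℝ (Space d →L[ℝ] Space d)).coeFn_holder (r := 2)
    P.κ (H10.grad u)] with x hx hx'
  simp only [diffusion]
  rw [hx', real_inner_self_eq_norm_sq]
  exact hx _

theorem B_sub (w z : U 𝒯) : P.B 𝒯 (w - z) = P.B 𝒯 w - P.B 𝒯 z := by
  have h1 : (w - z).1 = w.1 - z.1 := rfl
  have h2 : (w - z).2.1.1 = w.2.1.1 - z.2.1.1 := rfl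
  have h3 : (w - z).2.2.1 = w.2.2.1 - z.2.2.1 := rfl
  have h4 : (w - z).2.2.2 = w.2.2.2 - z.2.2.2 := rfl
  ext v
  simp only [B, flux_eq, h1, h2, h3, h4, diffusion_sub, advection_sub]
  simp only [add_apply, sub_apply, ContinuousLinearMap.comp_apply, innerSL_apply_apply,
    inner_add_left, inner_sub_left]
  ring

theorem B_apply (w : U 𝒯) (v : V 𝒯) :
    P.B 𝒯 w v = ⟪P.diffusion w.1, V.grad 𝒯 v⟫ + ⟪P.advection w.2.2.1, V.grad 𝒯 v⟫
      - w.2.1.1 v + ⟪w.2.2.2, V.val 𝒯 v⟫ := by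
  rw [← inner_add_left]
  rfl

theorem abs_inner_grad_le (τ : L2Vec P.Ω) (v : V 𝒯) :
    |⟪τ, V.grad 𝒯 v⟫| ≤ ‖τ‖ * ‖v‖ :=
  (abs_real_inner_le_norm _ _).trans
    (mul_le_mul_of_nonneg_left (V.norm_grad_le v) (norm_nonneg _))

theorem abs_inner_val_le (q : L2 P.Ω) (v : V 𝒯) :
    |⟪q, V.val 𝒯 v⟫| ≤ ‖q‖ * ‖v‖ :=
  (abs_real_inner_le_norm _ _).trans
    (mul_le_mul_of_nonneg_left (V.norm_val_le v) (norm_nonneg _))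

theorem norm_B_le (w : U 𝒯) :
    ‖P.B 𝒯 w‖ ≤ ‖P.diffusion w.1‖ + ‖P.β‖ * ‖w.2.2.1‖ + traceNorm w.2.1 + ‖w.2.2.2‖ := by
  have h0 := traceNorm_nonneg w.2.1
  refine ContinuousLinearMap.opNorm_le_bound _ (by positivity) fun v => ?_
  have h1 := P.abs_inner_grad_le (P.diffusion w.1) v
  have h2 := P.abs_inner_grad_le (P.advection w.2.2.1) v
  have h3 := P.abs_inner_val_le w.2.2.2 v
  have h4 : |w.2.1.1 v| ≤ traceNorm w.2.1 * ‖v‖ :=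
    (w.2.1.1.le_opNorm v).trans
      (mul_le_mul_of_nonneg_right (norm_le_traceNorm _) (norm_nonneg _))
  have h5 := mul_le_mul_of_nonneg_right (P.norm_advection_le w.2.2.1) (norm_nonneg v)
  rw [B_apply, Real.norm_eq_abs]
  rw [abs_le] at *
  constructor <;> linarith [h1.1, h1.2, h2.1, h2.2, h3.1, h3.2, h4.1, h4.2]

/-- The trace component is controlled by `B` and the other components. -/
theorem traceNorm_le (w : U 𝒯) :
    traceNorm w.2.1 ≤
      ‖P.B 𝒯 w‖ + ‖P.diffusion w.1‖ + ‖P.β‖ * ‖w.2.2.1‖ + ‖w.2.2.2‖ := by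
  refine (traceNorm_le_norm _).trans
    (ContinuousLinearMap.opNorm_le_bound _ (by positivity) fun v => ?_)
  have h1 := P.abs_inner_grad_le (P.diffusion w.1) v
  have h2 := P.abs_inner_grad_le (P.advection w.2.2.1) v
  have h3 := P.abs_inner_val_le w.2.2.2 v
  have h4 : |P.B 𝒯 w v| ≤ ‖P.B 𝒯 w‖ * ‖v‖ := (P.B 𝒯 w).le_opNorm v
  have h5 := mul_le_mul_of_nonneg_right (P.norm_advection_le w.2.2.1) (norm_nonneg v)
  have h6 := P.B_apply w v
  rw [Real.norm_eq_abs]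
  rw [abs_le] at *
  constructor <;> linarith [h1.1, h1.2, h2.1, h2.2, h3.1, h3.2, h4.1, h4.2]

/-- The gradient component is controlled by `B` and the `L_2` components: test with the first
component, for which the traces vanish. -/
theorem norm_grad_sq_le {κ₀ : ℝ}
    (hκ : ∀ᵐ x ∂(volume.restrict P.Ω), ∀ ξ : Space d, κ₀ * ‖ξ‖ ^ 2 ≤ ⟪P.κ x ξ, ξ⟫) (w : U 𝒯) :
    κ₀ * ‖H10.grad w.1‖ ^ 2 ≤
      ‖P.B 𝒯 w‖ * (‖H10.val w.1‖ + ‖H10.grad w.1‖) +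
        ‖P.β‖ * ‖w.2.2.1‖ * ‖H10.grad w.1‖ + ‖w.2.2.2‖ * ‖H10.val w.1‖ := by
  let v : V 𝒯 := H10.toV 𝒯 w.1
  have h0 := P.le_inner_diffusion hκ w.1
  have hb : P.B 𝒯 w v = ⟪P.diffusion w.1, H10.grad w.1⟫ +
      ⟪P.advection w.2.2.1, H10.grad w.1⟫ + ⟪w.2.2.2, H10.val w.1⟫ := by
    rw [B_apply, TraceSpace.apply_H10, sub_zero]
    rfl
  have hv : ‖v‖ ≤ ‖H10.val w.1‖ + ‖H10.grad w.1‖ := by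
    rw [← sq_le_sq₀ (norm_nonneg _) (by positivity), Submodule.coe_norm,
      WithLp.prod_norm_sq_eq_of_L2]
    change ‖H10.val w.1‖ ^ 2 + ‖H10.grad w.1‖ ^ 2 ≤ _
    nlinarith [mul_nonneg (norm_nonneg (H10.val w.1)) (norm_nonneg (H10.grad w.1))]
  have h1 : P.B 𝒯 w v ≤ ‖P.B 𝒯 w‖ * (‖H10.val w.1‖ + ‖H10.grad w.1‖) :=
    (le_abs_self _).trans (((P.B 𝒯 w).le_opNorm v).trans
      (mul_le_mul_of_nonneg_left hv (P.B 𝒯 w).opNorm_nonneg))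
  have h2 := (abs_le.1 (abs_real_inner_le_norm (P.advection w.2.2.1) (H10.grad w.1))).1
  have h3 := (abs_le.1 (abs_real_inner_le_norm w.2.2.2 (H10.val w.1))).1
  have h4 := mul_le_mul_of_nonneg_right (P.norm_advection_le w.2.2.1)
    (norm_nonneg (H10.grad w.1))
  linarith

/-- For `w ∈ U_h` the value at `v` equals the value at `Π_F v ∈ V_h`, so only discrete test
functions matter, at the price of `C_F`. -/
theorem norm_B_le_of_isFortin {Uh : Submodule ℝ (U 𝒯)} {Vh : Submodule ℝ (V 𝒯)} {CF : ℝ}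
    (hCF : 0 ≤ CF) {PiF : V 𝒯 → Vh} (hF : P.IsFortin Uh Vh CF PiF) {w : U 𝒯} (hw : w ∈ Uh) :
    ‖P.B 𝒯 w‖ ≤ CF * discreteDualNorm Vh (P.B 𝒯 w) := by
  refine ContinuousLinearMap.opNorm_le_bound _
    (mul_nonneg hCF (discreteDualNorm_nonneg _ _)) fun v => ?_
  have h1 : P.B 𝒯 w v = P.B 𝒯 w (PiF v) := by
    have := (hF v).2 w hw
    rwa [map_sub, sub_eq_zero] at this
  rw [h1, Real.norm_eq_abs]
  calc |P.B 𝒯 w (PiF v)| ≤ discreteDualNorm Vh (P.B 𝒯 w) * ‖PiF v‖ :=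
        abs_apply_le_discreteDualNorm _ _ _
    _ ≤ discreteDualNorm Vh (P.B 𝒯 w) * (CF * ‖v‖) :=
        mul_le_mul_of_nonneg_left (hF v).1 (discreteDualNorm_nonneg _ _)
    _ = _ := by ring

variable {P} in
/-- The extended solution satisfies `B𝐮 = L`. -/
theorem IsSolution.B_extended {f : L2 P.Ω} {u : H10 P.Ω} (hu : P.IsSolution f u)
    (𝒯 : Triangulation P.Ω) : P.B 𝒯 (hu.extended 𝒯) = load 𝒯 f := by
  ext v
  have h1 : P.B 𝒯 (hu.extended 𝒯) v =
      ⟪P.flux u (P.rho (H10.val u)), V.grad 𝒯 v⟫ -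
        (⟪P.gam (H10.val u) - f, V.val 𝒯 v⟫ + ⟪P.flux u (P.rho (H10.val u)), V.grad 𝒯 v⟫) +
        ⟪P.gam (H10.val u), V.val 𝒯 v⟫ := rfl
  have h2 : load 𝒯 f v = ⟪f, V.val 𝒯 v⟫ := rfl
  rw [h1, h2, inner_sub_left]
  ring

/-! ### Residuals and minimizers -/

/-- Each of the three terms of the residual is bounded by its square root. -/
theorem terms_le_of_residual_le {f : L2 P.Ω} {Vh : Submodule ℝ (V 𝒯)} {w : U 𝒯} {A : ℝ}
    (hA : 0 ≤ A) (h : P.residual f Vh w ≤ A ^ 2) :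
    discreteDualNorm Vh (P.B 𝒯 w - load 𝒯 f) ≤ A ∧
      ‖P.rho (H10.val w.1) - w.2.2.1‖ ≤ A ∧ ‖P.gam (H10.val w.1) - w.2.2.2‖ ≤ A := by
  rw [residual] at h
  have h1 := sq_nonneg (discreteDualNorm Vh (P.B 𝒯 w - load 𝒯 f))
  have h2 := sq_nonneg ‖P.rho (H10.val w.1) - w.2.2.1‖
  have h3 := sq_nonneg ‖P.gam (H10.val w.1) - w.2.2.2‖
  exact ⟨abs_le_of_sq_le_sq' (by linarith) hA |>.2, abs_le_of_sq_le_sq' (by linarith) hA |>.2,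
    abs_le_of_sq_le_sq' (by linarith) hA |>.2⟩

/-- The residual is bounded by the error. -/
theorem exists_residual_le : ∃ A : ℝ, 0 < A ∧ ∀ (f : L2 P.Ω) (u : H10 P.Ω)
    (hu : P.IsSolution f u) (𝒯 : Triangulation P.Ω) (Vh : Submodule ℝ (V 𝒯)) (w : U 𝒯),
    P.residual f Vh w ≤ (A * normU (hu.extended 𝒯 - w)) ^ 2 ∧
      ‖P.B 𝒯 (hu.extended 𝒯 - w)‖ ≤ A * normU (hu.extended 𝒯 - w) := by
  obtain ⟨CP, hCP, hCP'⟩ := H10.norm_val_le P.dim P.bounded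
  obtain ⟨M, hM, hM'⟩ := P.norm_diffusion_le
  obtain ⟨Kρ, hKρ⟩ := P.ρ_lipschitz
  obtain ⟨Kγ, hKγ⟩ := P.γ_lipschitz
  -- `A₁` is the continuity constant of `B`; its `2` stems from the trace and the last component. In
  -- `A₂` and `A₃`, a Lipschitz constant times the Friedrichs constant bounds the nonlinear
  -- difference and `1` the component itself.
  let A₁ := M + ‖P.β‖ + 2
  let A₂ := Kρ * CP + 1
  let A₃ := Kγ * CP + 1
  have hA₁ : 0 < A₁ := by positivity
  have hA₂ : 0 < A₂ := by positivity
  have hA₃ : 0 < A₃ := by positivity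
  refine ⟨A₁ + A₂ + A₃, by positivity, fun f u hu 𝒯 Vh w => ?_⟩
  set e := hu.extended 𝒯 - w
  have hN : 0 ≤ normU e := Real.sqrt_nonneg _
  have hgrad : ‖H10.grad (u - w.1)‖ ≤ normU e := norm_grad_le_normU e
  have hval : ‖H10.val u - H10.val w.1‖ ≤ CP * normU e :=
    (hCP' (u - w.1)).trans (mul_le_mul_of_nonneg_left hgrad hCP)
  have hB : ‖P.B 𝒯 e‖ ≤ A₁ * normU e := by
    have h1 := P.norm_B_le e
    have h2 := (hM' e.1).trans (mul_le_mul_of_nonneg_left (norm_grad_le_normU e) hM)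
    have h3 := mul_le_mul_of_nonneg_left (norm_third_le_normU e) (norm_nonneg P.β)
    have h4 := traceNorm_le_normU e
    have h5 := norm_fourth_le_normU e
    calc _ ≤ M * normU e + ‖P.β‖ * normU e + normU e + normU e := by linarith
      _ = A₁ * normU e := by ring
  have hdual : discreteDualNorm Vh (P.B 𝒯 w - load 𝒯 f) ≤ A₁ * normU e := by
    refine (discreteDualNorm_le_norm _ _).trans ?_
    rw [← hu.B_extended 𝒯, norm_sub_rev (P.B 𝒯 w), ← B_sub]
    exact hB
  have hrho : ‖P.rho (H10.val w.1) - w.2.2.1‖ ≤ A₂ * normU e := by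
    have h1 := norm_sub_le_norm_sub_add_norm_sub (P.rho (H10.val w.1)) (P.rho (H10.val u)) w.2.2.1
    have h2 := P.norm_rho_sub_le hKρ (H10.val w.1) (H10.val u)
    rw [norm_sub_rev (H10.val w.1)] at h2
    have h3 := mul_le_mul_of_nonneg_left hval Kρ.2
    have h4 : ‖P.rho (H10.val u) - w.2.2.1‖ ≤ normU e := norm_third_le_normU e
    calc _ ≤ Kρ * (CP * normU e) + normU e := h1.trans (add_le_add (h2.trans h3) h4)
      _ = A₂ * normU e := by ring
  have hgam : ‖P.gam (H10.val w.1) - w.2.2.2‖ ≤ A₃ * normU e := by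
    have h1 := norm_sub_le_norm_sub_add_norm_sub (P.gam (H10.val w.1)) (P.gam (H10.val u)) w.2.2.2
    have h2 := P.norm_gam_sub_le hKγ (H10.val w.1) (H10.val u)
    rw [norm_sub_rev (H10.val w.1)] at h2
    have h3 := mul_le_mul_of_nonneg_left hval Kγ.2
    have h4 : ‖P.gam (H10.val u) - w.2.2.2‖ ≤ normU e := norm_fourth_le_normU e
    calc _ ≤ Kγ * (CP * normU e) + normU e := h1.trans (add_le_add (h2.trans h3) h4)
      _ = A₃ * normU e := by ring
  constructor
  · have h1 := pow_le_pow_left₀ (discreteDualNorm_nonneg _ _) hdual 2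
    have h2 := pow_le_pow_left₀ (norm_nonneg _) hrho 2
    have h3 := pow_le_pow_left₀ (norm_nonneg _) hgam 2
    rw [residual]
    have h12 : 0 ≤ A₁ * A₂ + A₁ * A₃ + A₂ * A₃ := by positivity
    calc _ ≤ (A₁ * normU e) ^ 2 + (A₂ * normU e) ^ 2 + (A₃ * normU e) ^ 2 := by linarith
      _ ≤ (A₁ * normU e) ^ 2 + (A₂ * normU e) ^ 2 + (A₃ * normU e) ^ 2 +
          2 * (A₁ * A₂ + A₁ * A₃ + A₂ * A₃) * normU e ^ 2 :=
        le_add_of_nonneg_right (by positivity)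
      _ = ((A₁ + A₂ + A₃) * normU e) ^ 2 := by ring
  · refine hB.trans (mul_le_mul_of_nonneg_right ?_ hN)
    linarith

/-- The error of a minimizer is controlled in the dual norm, by means of the Fortin operator,
and its `L_2` components are consistent up to the best approximation error. -/
theorem exists_minimizer_bounds {CF : ℝ} (hCF : 0 < CF) : ∃ A : ℝ, 0 < A ∧
    ∀ (f : L2 P.Ω) (u : H10 P.Ω) (hu : P.IsSolution f u) (𝒯 : Triangulation P.Ω)
      (Uh : Submodule ℝ (U 𝒯)) (Vh : Submodule ℝ (V 𝒯)) (PiF : V 𝒯 → Vh)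
      (_ : P.IsFortin Uh Vh CF PiF) (uh : U 𝒯) (_ : P.IsDiscreteMinimizer f Uh Vh uh),
      ∀ wh ∈ Uh,
        ‖P.B 𝒯 (hu.extended 𝒯 - uh)‖ ≤ A * normU (hu.extended 𝒯 - wh) ∧
        ‖P.rho (H10.val uh.1) - uh.2.2.1‖ ≤ A * normU (hu.extended 𝒯 - wh) ∧
        ‖P.gam (H10.val uh.1) - uh.2.2.2‖ ≤ A * normU (hu.extended 𝒯 - wh) := by
  obtain ⟨A, hA, hA'⟩ := P.exists_residual_le
  -- The first `A` bounds `B(𝐮 - 𝐰_h)`. The rest bounds `B(𝐰_h - 𝐮_h)` by `C_F` times the two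
  -- discrete residuals at `𝐰_h` and `𝐮_h`.
  refine ⟨A + 2 * CF * A, by positivity, fun f u hu 𝒯 Uh Vh PiF hF uh huh wh hwh => ?_⟩
  obtain ⟨hres, hB⟩ := hA' f u hu 𝒯 Vh wh
  set N := normU (hu.extended 𝒯 - wh)
  have hN0 : 0 ≤ N := Real.sqrt_nonneg _
  obtain ⟨h1, h2, h3⟩ := P.terms_le_of_residual_le (by positivity)
    ((huh.2 wh hwh).trans hres)
  obtain ⟨h4, -, -⟩ := P.terms_le_of_residual_le (by positivity) hres
  have hAN : 0 ≤ CF * (A * N) := by positivity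
  have h5 : ‖P.B 𝒯 (wh - uh)‖ ≤ CF * (A * N + A * N) := by
    refine (P.norm_B_le_of_isFortin hCF.le hF (Uh.sub_mem hwh huh.1)).trans
      (mul_le_mul_of_nonneg_left ?_ hCF.le)
    -- Inserting `L` writes the difference as `(B𝐰_h - L) - (B𝐮_h - L)`.
    rw [B_sub, ← sub_sub_sub_cancel_right _ _ (load 𝒯 f)]
    exact (discreteDualNorm_sub_le _ _ _).trans (add_le_add h4 h1)
  have h6 : P.B 𝒯 (hu.extended 𝒯 - uh) =
      P.B 𝒯 (hu.extended 𝒯 - wh) + P.B 𝒯 (wh - uh) := by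
    simp only [B_sub]
    abel
  refine ⟨?_, by linarith, by linarith⟩
  rw [h6]
  refine (ContinuousLinearMap.opNorm_add_le _ _).trans ?_
  linarith

end ProblemData

end SemilinearDPG

end

/-- The constant `C` depends only on the data `Ω, κ, β, ρ, γ` and on the Fortin constant `CF`;
how small `h` has to be depends in addition on the function `c`. The number `h` is the parameter
of the discretization (for instance the largest diameter of the elements). -/
theorem theorem3p1 {d : ℕ} (P : ProblemData d) (CF : ℝ) (hCF : 0 < CF) :
    ∃ C : ℝ, 0 < C ∧
      ∀ c : ℝ → ℝ, (∀ h : ℝ, 0 < h → 0 < c h) → Tendsto c (𝓝[>] 0) (𝓝 0) →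
        ∃ h₀ : ℝ, 0 < h₀ ∧
          ∀ (h : ℝ) (_ : 0 < h) (_ : h ≤ h₀)
            (f : L2 P.Ω) (u : H10 P.Ω) (hu : P.IsSolution f u)
            (𝒯 : Triangulation P.Ω)
            (Uh : Submodule ℝ (U 𝒯)) (_ : FiniteDimensional ℝ Uh)
            (Vh : Submodule ℝ (V 𝒯)) (_ : FiniteDimensional ℝ Vh)
            (_ : ∃ PiF : V 𝒯 → Vh, P.IsFortin Uh Vh CF PiF)
            (uh : U 𝒯) (_ : P.IsDiscreteMinimizer f Uh Vh uh)
            (_ : ‖H10.val (u - uh.1)‖ ≤ c h * ‖H10.grad (u - uh.1)‖),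
            ∀ wh ∈ Uh, normU (hu.extended 𝒯 - uh) ≤ C * normU (hu.extended 𝒯 - wh) := by
  obtain ⟨κ₀, hκ₀, hκ⟩ := P.κ_pos
  obtain ⟨M, hM, hM'⟩ := P.norm_diffusion_le
  obtain ⟨Kρ, hKρ⟩ := P.ρ_lipschitz
  obtain ⟨Kγ, hKγ⟩ := P.γ_lipschitz
  obtain ⟨A, hA, hA'⟩ := P.exists_minimizer_bounds hCF
  obtain ⟨C, ε, hC, hε, hCε⟩ := exists_quasi_optimality_constant hκ₀ hM (norm_nonneg P.β)
    Kρ.2 Kγ.2 hA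
  refine ⟨C, hC, fun c _ hc => ?_⟩
  have hev : ∀ᶠ h in 𝓝[>] (0 : ℝ), c h < ε := hc.eventually_lt_const hε
  obtain ⟨h₀, hh₀, hsub⟩ := mem_nhdsGT_iff_exists_Ioc_subset.1 hev
  refine ⟨h₀, hh₀, fun h hpos hle f u hu 𝒯 Uh _ Vh _ hPi uh huh hclose wh hwh => ?_⟩
  obtain ⟨PiF, hF⟩ := hPi
  have hch : c h < ε := hsub ⟨hpos, hle⟩
  obtain ⟨hB, hrho, hgam⟩ := hA' f u hu 𝒯 Uh Vh PiF hF uh huh wh hwh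
  -- As `q = ρ(u)`, the error `q - q_h` splits at `ρ(u_h)` into a Lipschitz term and the defect of
  -- the minimizer; the same is done for `γ`.
  have hs := (norm_sub_le_norm_sub_add_norm_sub (P.rho (H10.val u)) (P.rho (H10.val uh.1))
    uh.2.2.1).trans (add_le_add (P.norm_rho_sub_le hKρ _ _) hrho)
  have ht := (norm_sub_le_norm_sub_add_norm_sub (P.gam (H10.val u)) (P.gam (H10.val uh.1))
    uh.2.2.2).trans (add_le_add (P.norm_gam_sub_le hKγ _ _) hgam)
  have htrace := P.traceNorm_le (hu.extended 𝒯 - uh)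
  have hdiff := hM' (hu.extended 𝒯 - uh).1
  refine (normU_le_add _).trans (hCε (v := ‖H10.val (u - uh.1)‖) (Real.sqrt_nonneg _)
    (norm_nonneg _) (norm_nonneg _)
    (hclose.trans (mul_le_mul_of_nonneg_right hch.le (norm_nonneg _))) hB hs ht
    (P.norm_grad_sq_le hκ (hu.extended 𝒯 - uh)) ?_)
  -- The remaining goal is the trace bound: `htrace` with the diffusion term estimated by `hdiff`.
  linarith
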